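/- Notation. For $(z,w)\in\mathbb C^{n-1}\times\mathbb C$ let $\partial\mathbb H_n=\{\operatorname{Im} w=|z|^2\}$, $\langle a,b\rangle=\sum a_jb_j$, $T=\partial/\partial u$ ($u=\operatorname{Re}w$), $L_j=\frac{\partial}{\partial z_j}+2i\bar z_j\frac{\partial}{\partial w}$. For a CR function on $\partial\mathbb H_n$ put $\frac{\partial}{\partial w}:=T$ and $\frac{\partial}{\partial z_j}:=L_j-2i\bar z_jT$. For $F=(f,\phi,g)=(\tilde f,g)$ with values in $\partial\mathbb H_N$ the CR Gauss map is $\gamma=P^{-1}Q$, where $P$ has rows $(L_jf,L_jg)$ $(1\le j\le n-1)$ and $(Tf,Tg)$, and $Q$ has rows $L_j\phi$ and $T\phi$. For $a\in\mathbb C^k$, $r\in\mathbb R$ let $$\Theta_{a,r}(z,w)=\frac{(z-aw,\;w)}{1+2i\langle\bar a,z\rangle+(r-i|a|^2)w}.$$ Renormalized maps. For $p=(z_0,w_0)\in\partial\mathbb H_n$ let $\sigma_p^0(z,w)=(z+z_0,w+w_0+2i\langle z,\bar z_0\rangle)$ and $F_p=\tau_p^F\circ F\circ\sigma_p^0$ with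 $\tau^F_p(z^*,w^*)=(z^*-\tilde f(p),\,w^*-\overline{g(p)}-2i\langle z^*,\overline{\tilde f(p)}\rangle)$. Let $E_l=\frac{\partial\tilde f_p}{\partial z_l}(0)$ and $\lambda=Tg(p)-2i\langle T\tilde f(p),\overline{\tilde f(p)}\rangle$. If $\lambda>0$ and $C_1,\dots,C_{N-n}\in\mathbb C^{N-1}$ are such that the matrix $A$ with columns $E_l/\sqrt\lambda$ and $C_l$ is unitary, let $$F_p^*=\big(\lambda^{-1/2}\tilde f_p\bar A,\ \lambda^{-1}g_p\big),\qquad F_p^{**}=\Theta_{a,r}\circ F_p^*,\quad a=\tfrac{\partial\tilde f_p^*}{\partial w}(0),\ r=\tfrac12\operatorname{Re}\tfrac{\partial^2g_p^*}{\partial w^2}(0).$$ For unitary matrices $U$ (of size $n-1$), $U^*$ (of size $N-n$; an independent matrix) and $c\in\mathbb C^{n-1}$ let $$F_p^{***}(z,w)=\big(f_p^{**}(zU,w)U^{-1},\,\phi_p^{**}(zU,w)U^*,\,g_p^{**}(zU,w)\big),\qquad F_p^{****}=\Theta_{(-c,0),0}\circ F_p^{***}\circ\Theta_{c,0},$$ and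 write $F_p^{****}=(f_p^{****},\phi_p^{****},g_p^{****})$. The corresponding change of the source is $\Psi(z,w)=\sigma_p^0\big(\zeta U,\eta\big)$, where $(\zeta,\eta)=\Theta_{c,0}(z,w)$; it maps $0$ to $p$. The geometric rank of $F$ at $p$ is the rank of the $(n-1)\times(n-1)$ matrix $-2i\big(\frac{\partial^2(f^{**}_p)_l}{\partial z_j\partial w}(0)\big)_{j,l}$. Normal form. Put $\mathcal S_0=\{(j,l):1\le j\le\kappa_0,\ j\le l\le n-1\}$ and let $\mathcal S_1$ be an index set with $N-n-\frac{(2n-\kappa_0-1)\kappa_0}2\ (\ge0)$ elements; the components of $\phi$ are indexed by $\mathcal S_0\sqcup\mathcal S_1$. $F$ has the normal form with parameter $\kappa_0$ if, for some $\mu_1,\dots,\mu_{\kappa_0}>0$, some linear forms $b_{lj}^{(1)}(z)$ and some functions $f^*_{lj},\phi^*_{kj}$, on $\partial\mathbb H_n$ near $0$: $f_l=\sum_{j\le\kappa_0}z_jf^*_{lj}$ for $l\le\kappa_0$; $f_j=z_j$ for $j>\kappa_0$; $g=w$; $\phi_{jl}=\mu_{jl}z_jz_l+\sum_{h\le\kappa_0}z_h\phi^*_{(jl)h}$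 for $(j,l)\in\mathcal S_0$; $\phi_k=\sum_{h\le\kappa_0}z_h\phi^*_{kh}=O_{wt}(3)$ for $k\in\mathcal S_1$; $f^*_{lj}=\delta_l^j+\frac{i\delta_l^j\mu_l}2w+b^{(1)}_{lj}(z)w+O_{wt}(4)$; $\phi^*_{kh}=O_{wt}(2)$ for all $k\in\mathcal S_0\sqcup\mathcal S_1$. Here $\mu_{jl}=\sqrt{\mu_j+\mu_l}$ if $j<l\le\kappa_0$ and $\mu_{jl}=\sqrt{\mu_j}$ otherwise, and $O_{wt}(k)$ means $O\big((|z|+|w|^{1/2})^k\big)$ as $(z,w)\to0$ in $\partial\mathbb H_n$. **Theorem.** Let $1\le\kappa_0\le n-1$ and let $F$ be a $C^2$ CR immersion of $\partial\mathbb H_n$, or of an open neighborhood of $0$ in $\partial\mathbb H_n$, into $\partial\mathbb H_N$. Suppose that the geometric rank of $F$ at $0$ is $\kappa_0$, that it is maximal among the geometric ranks of $F$ at the points of its domain, and that $F$ has the normal form with parameter $\kappa_0$. Then for every $p\in\partial\mathbb H_n$ sufficiently close to $0$ the matrix $P(p)$ is invertible, there are $\lambda>0$ and $C_1,\dots,C_{N-n}$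 as above, and for every such choice, all unitary $U,U^*$ and all $c$ (in particular those by which $F_p^{***}$ and $F_p^{****}$ are further normalized), the CR Gauss map equation $\gamma=\gamma(p)$ near $p$, expressed in terms of $F_p^{****}$, takes the form $$\frac{\partial\phi_p^{****}}{\partial z_j}=O(|(z,w)|^2)\quad(1\le j\le n-1),\qquad\frac{\partial\phi_p^{****}}{\partial w}=O(|(z,w)|^2),$$ in the following precise sense. There is a complex linear form $\ell$ on $\mathbb C^N$ such that, with $q=1+\ell\circ F_p^{****}$, the functions $$R_j=(1-q)\frac{\partial\phi_p^{****}}{\partial z_j}+\phi_p^{****}\frac{\partial q}{\partial z_j},\qquad R_n=(1-q)\frac{\partial\phi_p^{****}}{\partial w}+\phi_p^{****}\frac{\partial q}{\partial w}$$ are $O(|(z,w)|^2)$ as $(z,w)\to0$ in $\partial\mathbb H_n$, and for all $(z,w)\in\partial\mathbb H_n$ sufficiently close to $0$ $$\gamma\big(\Psi(z,w)\big)=\gamma(p)\iff\frac{\partial\phi_p^{****}}{\partial z_j}(z,w)=R_j(z,w)\ (1\le j\le n-1)\ \text{ and }\ \frac{\partial\phi_p^{****}}{\partial w}(z,w)=R_n(z,w).$$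 -/

import Mathlib

open Filter Topology Asymptotics

noncomputable section

namespace CRGauss

/-- Points `(z, w)` of `ℂ^α × ℂ`. -/
abbrev CSp (α : Type) : Type := (α → ℂ) × ℂ

/-- `|z|² = ∑ |z_i|²`. -/
def sqn {α : Type} [Fintype α] (z : α → ℂ) : ℝ := ∑ i, Complex.normSq (z i)

/-- The hypersurface `{(z, w) : Im w = |z|²}`; for `α = Fin (n - 1)` this is `∂ℍ_n`. -/
def heis (α : Type) [Fintype α] : Set (CSp α) := {x | x.2.im = sqn x.1}

/-- The global parametrization `(z, u) ↦ (z, u + i |z|²)` of `heis α`. -/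
def par {α : Type} [Fintype α] (y : (α → ℂ) × ℝ) : CSp α :=
  (y.1, (y.2 : ℂ) + Complex.I * (sqn y.1 : ℂ))

/-! Differential operators on functions on `∂ℍ_n`, written in the parameters `(z, u)`.
They only see the values of the function on `∂ℍ_n`. -/

section operators

variable {m : ℕ}

/-- The real derivative at `x`, in the direction `v`, of `h` in the parameters `(z, u)`. -/
def dirD (h : CSp (Fin m) → ℂ) (x : CSp (Fin m)) (v : (Fin m → ℂ) × ℝ) : ℂ :=
  fderiv ℝ (fun y => h (par y)) (x.1, x.2.re) v

/-- `T = ∂/∂u`. On the boundary values of a holomorphic function this is `∂/∂w`. -/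
def opT (h : CSp (Fin m) → ℂ) (x : CSp (Fin m)) : ℂ := dirD h x (0, 1)

/-- The Wirtinger derivative `∂/∂z_j` in the parameters `(z, u)`. -/
def wirt (j : Fin m) (h : CSp (Fin m) → ℂ) (x : CSp (Fin m)) : ℂ :=
  (1 / 2) * (dirD h x (Pi.single j 1, 0) - Complex.I * dirD h x (Pi.single j Complex.I, 0))

/-- The Wirtinger derivative `∂/∂z̄_j` in the parameters `(z, u)`. -/
def wirtBar (j : Fin m) (h : CSp (Fin m) → ℂ) (x : CSp (Fin m)) : ℂ :=
  (1 / 2) * (dirD h x (Pi.single j 1, 0) + Complex.I * dirD h x (Pi.single j Complex.I, 0))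

/-- `L_j = ∂/∂z_j + 2 i z̄_j ∂/∂w`, which reads `∂/∂z_j + i z̄_j ∂/∂u` in the parameters. -/
def opL (j : Fin m) (h : CSp (Fin m) → ℂ) (x : CSp (Fin m)) : ℂ :=
  wirt j h x + Complex.I * star (x.1 j) * opT h x

/-- The conjugate field of `L_j`. -/
def opLbar (j : Fin m) (h : CSp (Fin m) → ℂ) (x : CSp (Fin m)) : ℂ :=
  wirtBar j h x - Complex.I * x.1 j * opT h x

/-- `∂/∂z_j = L_j - 2 i z̄_j T`, the `z_j`-derivative of a CR function on `∂ℍ_n`; on the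
boundary values of a holomorphic `H(z, w)` it is `∂H/∂z_j`. -/
def pdz (j : Fin m) (h : CSp (Fin m) → ℂ) (x : CSp (Fin m)) : ℂ :=
  opL j h x - 2 * Complex.I * star (x.1 j) * opT h x

/-- `∂/∂w`, the `w`-derivative of a CR function on `∂ℍ_n`. -/
def pdw (h : CSp (Fin m) → ℂ) (x : CSp (Fin m)) : ℂ := opT h x

end operators

/-! Maps `F = (f, φ, g)`: the target is `CSp (Fin m ⊕ ι)`, with `f_j = (F ·).1 (inl j)`,
`φ_k = (F ·).1 (inr k)`, `g = (F ·).2` and `f̃ = (f, φ) = (F ·).1`. -/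

section maps

variable {m : ℕ} {ι : Type} [Fintype ι]

/-- `F` is a `C²` CR immersion of the open piece `∂ℍ_n ∩ D` of `∂ℍ_n` into `∂ℍ_N`. -/
structure IsCRImmersion (F : CSp (Fin m) → CSp (Fin m ⊕ ι)) (D : Set (CSp (Fin m))) : Prop where
  contDiff : ContDiffOn ℝ 2 (fun y => F (par y)) (par ⁻¹' D)
  mapsTo : Set.MapsTo F (heis (Fin m) ∩ D) (heis (Fin m ⊕ ι))
  cr_tilde : ∀ x ∈ heis (Fin m) ∩ D, ∀ j k, opLbar j (fun y => (F y).1 k) x = 0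
  cr_g : ∀ x ∈ heis (Fin m) ∩ D, ∀ j, opLbar j (fun y => (F y).2) x = 0
  immersion : ∀ x ∈ heis (Fin m) ∩ D,
    Function.Injective (fderiv ℝ (fun y => F (par y)) (x.1, x.2.re))

/-! ### The CR Gauss map -/

/-- The rows `L_1, …, L_{n-1}, T`. -/
def rowOp : Fin m ⊕ Unit → (CSp (Fin m) → ℂ) → CSp (Fin m) → ℂ
  | Sum.inl j => opL j
  | Sum.inr _ => opT

/-- The square matrix with rows `(L_j f, L_j g)` and `(T f, T g)`. -/
def gaussP (F : CSp (Fin m) → CSp (Fin m ⊕ ι)) (x : CSp (Fin m)) :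
    Matrix (Fin m ⊕ Unit) (Fin m ⊕ Unit) ℂ :=
  Matrix.of fun a b => match b with
    | Sum.inl l => rowOp a (fun y => (F y).1 (Sum.inl l)) x
    | Sum.inr _ => rowOp a (fun y => (F y).2) x

/-- The matrix with rows `L_j φ` and `T φ`. -/
def gaussQ (F : CSp (Fin m) → CSp (Fin m ⊕ ι)) (x : CSp (Fin m)) :
    Matrix (Fin m ⊕ Unit) ι ℂ :=
  Matrix.of fun a k => rowOp a (fun y => (F y).1 (Sum.inr k)) x

/-- The CR Gauss map `γ`: the matrix `G` such that `(I G)` represents the `n`-plane spanned by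
the rows of `(P Q)`. -/
def gauss (F : CSp (Fin m) → CSp (Fin m ⊕ ι)) (x : CSp (Fin m)) :
    Matrix (Fin m ⊕ Unit) ι ℂ :=
  (gaussP F x)⁻¹ * gaussQ F x

/-! ### The renormalized maps -/

/-- The Heisenberg translation `σ⁰_p`, `p = (z₀, w₀)`. -/
def sigma0 {α : Type} [Fintype α] (p x : CSp α) : CSp α :=
  (x.1 + p.1, x.2 + p.2 + 2 * Complex.I * ∑ i, x.1 i * star (p.1 i))

/-- The translation that moves the point `v` of the hypersurface to `0`. With `v = F p` it is
`τ^F_p`. -/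
def tau0 {α : Type} [Fintype α] (v x : CSp α) : CSp α :=
  (x.1 - v.1, x.2 - star v.2 - 2 * Complex.I * ∑ i, x.1 i * star (v.1 i))

/-- The automorphism
`(z, w) ↦ (z - a w, w) / (1 + 2 i ⟨ā, z⟩ + (r - i |a|²) w)` of the hypersurface, fixing `0`. -/
def aut {α : Type} [Fintype α] (a : α → ℂ) (r : ℝ) (x : CSp α) : CSp α :=
  (1 + 2 * Complex.I * (∑ i, star (a i) * x.1 i) +
      ((r : ℂ) - Complex.I * (sqn a : ℂ)) * x.2)⁻¹ • (x.1 - x.2 • a, x.2)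

/-- `F_p = τ^F_p ∘ F ∘ σ⁰_p`. -/
def Fp (F : CSp (Fin m) → CSp (Fin m ⊕ ι)) (p x : CSp (Fin m)) : CSp (Fin m ⊕ ι) :=
  tau0 (F p) (F (sigma0 p x))

/-- `E_l(p) = ∂f̃_p/∂z_l (0)`. -/
def vecE (F : CSp (Fin m) → CSp (Fin m ⊕ ι)) (p : CSp (Fin m)) (l : Fin m) : Fin m ⊕ ι → ℂ :=
  fun i => pdz l (fun x => (Fp F p x).1 i) 0

/-- `λ(p) = g'_w(p) - 2 i ⟨f̃'_w(p), conj f̃(p)⟩`, a real number. -/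
def lam (F : CSp (Fin m) → CSp (Fin m ⊕ ι)) (p : CSp (Fin m)) : ℝ :=
  (pdw (fun x => (F x).2) p -
    2 * Complex.I * ∑ i, pdw (fun x => (F x).1 i) p * star ((F p).1 i)).re

/-- The matrix `A(p)` with columns `E_1/√λ, …, E_{n-1}/√λ, C_1, …, C_{N-n}`. -/
def matA (F : CSp (Fin m) → CSp (Fin m ⊕ ι)) (p : CSp (Fin m)) (C : ι → Fin m ⊕ ι → ℂ) :
    Matrix (Fin m ⊕ ι) (Fin m ⊕ ι) ℂ :=
  Matrix.of fun i k => match k with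
    | Sum.inl l => vecE F p l i / (Real.sqrt (lam F p) : ℂ)
    | Sum.inr l => C l i

/-- The vectors `C_1, …, C_{N-n}` are an admissible choice at `p`: `λ(p) > 0` and `A(p)` is
unitary. -/
def IsCompletion [DecidableEq ι] (F : CSp (Fin m) → CSp (Fin m ⊕ ι)) (p : CSp (Fin m))
    (C : ι → Fin m ⊕ ι → ℂ) : Prop :=
  0 < lam F p ∧ matA F p C ∈ Matrix.unitaryGroup (Fin m ⊕ ι) ℂ

/-- `F_p^*`: `f*_j = λ⁻¹ ⟨f̃_p, conj E_j⟩`, `φ*_l = λ^{-1/2} ⟨f̃_p, conj C_l⟩`, `g* = λ⁻¹ g_p`. -/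
def F1 (F : CSp (Fin m) → CSp (Fin m ⊕ ι)) (p : CSp (Fin m)) (C : ι → Fin m ⊕ ι → ℂ)
    (x : CSp (Fin m)) : CSp (Fin m ⊕ ι) :=
  (fun k => (∑ i, (Fp F p x).1 i * star (matA F p C i k)) / (Real.sqrt (lam F p) : ℂ),
    (Fp F p x).2 / (lam F p : ℂ))

/-- `(a, b) = ∂f̃*_p/∂w (0)`. -/
def vecA (F : CSp (Fin m) → CSp (Fin m ⊕ ι)) (p : CSp (Fin m)) (C : ι → Fin m ⊕ ι → ℂ) :
    Fin m ⊕ ι → ℂ :=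
  fun k => pdw (fun x => (F1 F p C x).1 k) 0

/-- `r = ½ Re ∂²g*_p/∂w² (0)`. -/
def numR (F : CSp (Fin m) → CSp (Fin m ⊕ ι)) (p : CSp (Fin m)) (C : ι → Fin m ⊕ ι → ℂ) : ℝ :=
  (1 / 2) * (pdw (pdw (fun x => (F1 F p C x).2)) 0).re

/-- `F_p^{**}`. -/
def F2 (F : CSp (Fin m) → CSp (Fin m ⊕ ι)) (p : CSp (Fin m)) (C : ι → Fin m ⊕ ι → ℂ)
    (x : CSp (Fin m)) : CSp (Fin m ⊕ ι) :=
  aut (vecA F p C) (numR F p C) (F1 F p C x)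

/-- The unitary change `(z, w) ↦ (z U, w)` of the source. -/
def srcU (U : Matrix (Fin m) (Fin m) ℂ) (x : CSp (Fin m)) : CSp (Fin m) :=
  (Matrix.vecMul x.1 U, x.2)

/-- `F_p^{***}(z, w) = (f^{**}(zU, w) U⁻¹, φ^{**}(zU, w) V, g^{**}(zU, w))`. -/
def F3 (F : CSp (Fin m) → CSp (Fin m ⊕ ι)) (p : CSp (Fin m)) (C : ι → Fin m ⊕ ι → ℂ)
    (U : Matrix (Fin m) (Fin m) ℂ) (V : Matrix ι ι ℂ) (x : CSp (Fin m)) : CSp (Fin m ⊕ ι) :=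
  (Sum.elim
      (Matrix.vecMul (fun l => (F2 F p C (srcU U x)).1 (Sum.inl l)) U⁻¹)
      (Matrix.vecMul (fun k => (F2 F p C (srcU U x)).1 (Sum.inr k)) V),
    (F2 F p C (srcU U x)).2)

/-- `F_p^{****} = τ ∘ F_p^{***} ∘ σ` with `σ(z, w) = (z - c w, w) / (1 + 2i⟨c̄, z⟩ - i|c|² w)` and
`τ(z, w) = (z + (c, 0) w, w) / (1 - 2i⟨(c̄, 0), z⟩ - i|c|² w)`. -/
def F4 (F : CSp (Fin m) → CSp (Fin m ⊕ ι)) (p : CSp (Fin m)) (C : ι → Fin m ⊕ ι → ℂ)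
    (U : Matrix (Fin m) (Fin m) ℂ) (V : Matrix ι ι ℂ) (c : Fin m → ℂ)
    (x : CSp (Fin m)) : CSp (Fin m ⊕ ι) :=
  aut (Sum.elim (-c) (fun _ => 0)) 0 (F3 F p C U V (aut c 0 x))

/-- The total change of the source coordinates in `F_p^{****}`; it maps `0` to `p`. -/
def srcChange (p : CSp (Fin m)) (U : Matrix (Fin m) (Fin m) ℂ) (c : Fin m → ℂ)
    (x : CSp (Fin m)) : CSp (Fin m) :=
  sigma0 p (srcU U (aut c 0 x))

/-! ### Geometric rank -/

/-- `𝒜(p) = -2 i (∂²(f_p^{**})_l / ∂z_j ∂w (0))_{j,l}`. -/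
def geomMatrix (F : CSp (Fin m) → CSp (Fin m ⊕ ι)) (p : CSp (Fin m)) (C : ι → Fin m ⊕ ι → ℂ) :
    Matrix (Fin m) (Fin m) ℂ :=
  Matrix.of fun j l =>
    -2 * Complex.I * pdz j (pdw (fun x => (F2 F p C x).1 (Sum.inl l))) 0

/-- The geometric rank of `F` at `p` is `k` (`f_p^{**}` does not depend on the admissible
choice of `C`). -/
def HasGeomRank [DecidableEq ι] (F : CSp (Fin m) → CSp (Fin m ⊕ ι)) (p : CSp (Fin m))
    (k : ℕ) : Prop :=
  ∃ C, IsCompletion F p C ∧ (geomMatrix F p C).rank = k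

/-- The geometric rank of `F` at `0` is `k`, and it is maximal among all points of the domain
`∂ℍ_n ∩ D`. -/
def HasMaxGeomRankAtZero [DecidableEq ι] (F : CSp (Fin m) → CSp (Fin m ⊕ ι))
    (D : Set (CSp (Fin m))) (k : ℕ) : Prop :=
  HasGeomRank F 0 k ∧ ∀ p ∈ heis (Fin m) ∩ D, ∀ k', HasGeomRank F p k' → k' ≤ k

end maps

/-! ### The normal form -/

/-- `h = O_wt(k)` at `0` on `∂ℍ_n`, where `z` has weight one and `w` has weight two. -/
def IsOwt {m : ℕ} (k : ℕ) (h : CSp (Fin m) → ℂ) : Prop :=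
  h =O[𝓝[heis (Fin m)] 0] fun x => (‖x.1‖ + Real.sqrt ‖x.2‖) ^ k

/-- The index set `𝒮₀ = {(j, l) : j ≤ κ, j ≤ l ≤ m}` (counted from zero here); it has
`κ (2 m + 1 - κ) / 2` elements. -/
abbrev S0 (m κ : ℕ) : Type := {jl : Fin m × Fin m // jl.1.val < κ ∧ jl.1 ≤ jl.2}

/-- The number `N - n - κ (2 n - κ - 1) / 2` of elements of `𝒮₁`. -/
abbrev cardS1 (n N κ : ℕ) : ℕ := N - n - κ * (2 * n - κ - 1) / 2

/-- The index set `𝒮 = 𝒮₀ ∪ 𝒮₁` of all `N - n` components of `φ`. -/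
abbrev S (n N κ : ℕ) : Type := S0 (n - 1) κ ⊕ Fin (cardS1 n N κ)

/-- `μ_{jl}`: `√(μ_j + μ_l)` for `j < l ≤ κ`, and `√μ_j` for `j = l ≤ κ` or `j ≤ κ < l`. -/
def muPair {m κ : ℕ} (μ : Fin m → ℝ) (jl : S0 m κ) : ℝ :=
  if jl.1.1 < jl.1.2 ∧ jl.1.2.val < κ then Real.sqrt (μ jl.1.1 + μ jl.1.2)
  else Real.sqrt (μ jl.1.1)

/-- The normal form of `F = (f, φ, g)` near `0`. -/
structure IsNormalFormWith {n N κ : ℕ}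
    (F : CSp (Fin (n - 1)) → CSp (Fin (n - 1) ⊕ S n N κ))
    (μ : Fin (n - 1) → ℝ)
    (b : Fin (n - 1) → Fin (n - 1) → (Fin (n - 1) → ℂ) →ₗ[ℂ] ℂ)
    (fs : Fin (n - 1) → Fin (n - 1) → CSp (Fin (n - 1)) → ℂ)
    (φs : S n N κ → Fin (n - 1) → CSp (Fin (n - 1)) → ℂ) : Prop where
  mu_pos : ∀ l, l.val < κ → 0 < μ l
  f_low : ∀ᶠ x in 𝓝[heis (Fin (n - 1))] 0, ∀ l, l.val < κ →
    (F x).1 (Sum.inl l) = ∑ j with j.val < κ, x.1 j * fs l j x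
  f_high : ∀ᶠ x in 𝓝[heis (Fin (n - 1))] 0, ∀ j, κ ≤ j.val → (F x).1 (Sum.inl j) = x.1 j
  phi_S0 : ∀ᶠ x in 𝓝[heis (Fin (n - 1))] 0, ∀ lk : S0 (n - 1) κ,
    (F x).1 (Sum.inr (Sum.inl lk)) =
      (muPair μ lk : ℂ) * x.1 lk.1.1 * x.1 lk.1.2 +
        ∑ j with j.val < κ, x.1 j * φs (Sum.inl lk) j x
  phi_S1 : ∀ᶠ x in 𝓝[heis (Fin (n - 1))] 0, ∀ i : Fin (cardS1 n N κ),
    (F x).1 (Sum.inr (Sum.inr i)) = ∑ j with j.val < κ, x.1 j * φs (Sum.inr i) j x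
  phi_S1_order : ∀ i : Fin (cardS1 n N κ), IsOwt 3 fun x => (F x).1 (Sum.inr (Sum.inr i))
  g_eq : ∀ᶠ x in 𝓝[heis (Fin (n - 1))] 0, (F x).2 = x.2
  fs_expansion : ∀ l j, l.val < κ → j.val < κ → IsOwt 4 fun x =>
    fs l j x - ((if l = j then 1 + Complex.I * (μ l : ℂ) / 2 * x.2 else 0) + b l j x.1 * x.2)
  phis_order : ∀ k j, j.val < κ → IsOwt 2 (φs k j)

/-- `F` has the normal form, for some `μ_j`, linear forms `b_{lj}^{(1)}` and functions
`f*_{lj}`, `φ*_{lkj}`. -/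
def HasNormalForm {n N κ : ℕ} (F : CSp (Fin (n - 1)) → CSp (Fin (n - 1) ⊕ S n N κ)) : Prop :=
  ∃ μ b fs φs, IsNormalFormWith F μ b fs φs

/-! ### Right-hand sides of the reduced system -/

section remainder

variable {m : ℕ} {ι : Type}

/-- `(1 - q) ∂_{z_j} φ_k + φ_k ∂_{z_j} q` for `q = 1 + ℓ ∘ H`, `H = (f, φ, g)`. -/
def remZ (H : CSp (Fin m) → CSp (Fin m ⊕ ι)) (ell : CSp (Fin m ⊕ ι) →ₗ[ℂ] ℂ)
    (j : Fin m) (k : ι) (x : CSp (Fin m)) : ℂ :=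
  -ell (H x) * pdz j (fun y => (H y).1 (Sum.inr k)) x +
    (H x).1 (Sum.inr k) * pdz j (fun y => 1 + ell (H y)) x

/-- `(1 - q) ∂_w φ_k + φ_k ∂_w q` for `q = 1 + ℓ ∘ H`, `H = (f, φ, g)`. -/
def remW (H : CSp (Fin m) → CSp (Fin m ⊕ ι)) (ell : CSp (Fin m ⊕ ι) →ₗ[ℂ] ℂ)
    (k : ι) (x : CSp (Fin m)) : ℂ :=
  -ell (H x) * pdw (fun y => (H y).1 (Sum.inr k)) x +
    (H x).1 (Sum.inr k) * pdw (fun y => 1 + ell (H y)) x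

end remainder

end CRGauss

end

/-! The derivative of a CR map along the hypersurface is the restriction to the tangent space of a
unique complex linear map `Λ` (`HasCRDeriv`). Where `P` is invertible, the Gauss map records only
the complex `n`-plane `Λ(ℂ^n)`: `γ = G` means that `gaussKer G` kills this plane
(`HasCRDeriv.gauss_eq_iff`).

All normalizations of the target are projective maps `v ↦ A v / (1 + M v)`, a class closed under
composition. Hence near `0` the map `H = F_p^{****}` equals `A K / (1 + M K)` with `K = F ∘ Ψ - F p`
(`F4_eq`), where `A` is invertible. The normalization makes the first derivative of the `φ`
component vanish at `0` (`autA_linF1_eq_zero`), so the composite of `A` with the projection `π` to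
the `φ` components kills the `n`-plane of `F` at `p`. By dimension, `ker (π A)` is that plane, and
`γ(Ψ x) = γ(p)` becomes `π A dK = 0` at `x`.

It remains to express this through `H`. Put `q = 1 / (1 + M K)`. Then `q = 1 - M A⁻¹ H`, so `q = 1 +
ℓ ∘ H` with `ℓ = -M A⁻¹`; and `φ = q π A K` gives `q dφ - φ dq = q² π A dK`
(`projMap_quotient_rule`). The equation is thus exactly `dφ = (1 - q) dφ + φ dq`. The right-hand
side is of second order because `q - 1` and `dφ` are of first order, `φ` is of second order and `dq`
is bounded. All of this is carried out in `exists_reduced_gauss_equation`.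

For the unitary completion, differentiating `Im g = |f̃|²` twice and using the tangential CR
equations shows that `E_1, …, E_{n-1}` are orthogonal of length `√λ` (`second_order_identity`).
Invertibility of `P` and positivity of `λ` near `0` follow by continuity: the normal form gives
`P(0) = I`, and an admissible completion at `0` includes `λ(0) > 0`. -/

namespace CRGauss

variable {m : ℕ}

/-! ### The parametrization and CR derivatives -/

/-- The coordinates `(z, Re w)` of a point. -/
def coord {α : Type} (x : CSp α) : (α → ℂ) × ℝ := (x.1, x.2.re)

theorem par_mem_heis {α : Type} [Fintype α] (y : (α → ℂ) × ℝ) : par y ∈ heis α := by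
  simp [heis, par]

theorem coord_par {α : Type} [Fintype α] (y : (α → ℂ) × ℝ) : coord (par y) = y := by
  simp [coord, par]

theorem par_coord {α : Type} [Fintype α] {x : CSp α} (hx : x ∈ heis α) : par (coord x) = x := by
  have : x.2.im = sqn x.1 := hx
  refine Prod.ext rfl (Complex.ext ?_ ?_) <;> simp [par, coord, this]

theorem zero_mem_heis {α : Type} [Fintype α] : (0 : CSp α) ∈ heis α := by
  simp [heis, sqn]

/-- The derivative of `par` at a point with first component `z`. -/
noncomputable def dpar {α : Type} [Fintype α] (z : α → ℂ) : ((α → ℂ) × ℝ) →L[ℝ] CSp α :=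
  (ContinuousLinearMap.fst ℝ (α → ℂ) ℝ).prod
    (Complex.ofRealCLM.comp (ContinuousLinearMap.snd ℝ (α → ℂ) ℝ) +
      Complex.I • Complex.ofRealCLM.comp (∑ i,
        ((2 * (z i).re) • Complex.reCLM + (2 * (z i).im) • Complex.imCLM).comp
          ((ContinuousLinearMap.proj i).comp (ContinuousLinearMap.fst ℝ (α → ℂ) ℝ))))

theorem dpar_apply {α : Type} [Fintype α] (z : α → ℂ) (v : (α → ℂ) × ℝ) :
    dpar z v = (v.1, (v.2 : ℂ) + 2 * Complex.I * ((∑ i, v.1 i * star (z i)).re : ℂ)) := by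
  refine Prod.ext rfl ?_
  simp only [dpar, ContinuousLinearMap.prod_apply, _root_.add_apply,
    ContinuousLinearMap.comp_apply, _root_.smul_apply, _root_.sum_apply,
    Complex.ofRealCLM_apply, Complex.reCLM_apply, Complex.imCLM_apply, ContinuousLinearMap.proj_apply,
    ContinuousLinearMap.coe_fst', ContinuousLinearMap.coe_snd', smul_eq_mul, Complex.re_sum]
  congr 1
  rw [mul_comm (2 : ℂ), mul_assoc, ← Complex.ofReal_ofNat 2, ← Complex.ofReal_mul, Finset.mul_sum]
  refine congrArg (fun r : ℝ => Complex.I * (r : ℂ)) (Finset.sum_congr rfl fun i _ => ?_)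
  simp
  ring

theorem hasFDerivAt_par {α : Type} [Fintype α] (y : (α → ℂ) × ℝ) :
    HasFDerivAt (𝕜 := ℝ) par (dpar y.1) y := by
  have h1 : ∀ i : α, HasFDerivAt (𝕜 := ℝ) (fun x : (α → ℂ) × ℝ => Complex.normSq (x.1 i))
      (((2 * (y.1 i).re) • Complex.reCLM + (2 * (y.1 i).im) • Complex.imCLM).comp
          ((ContinuousLinearMap.proj i).comp (ContinuousLinearMap.fst ℝ (α → ℂ) ℝ))) y := by
    intro i
    have hp : HasFDerivAt (𝕜 := ℝ) (fun x : (α → ℂ) × ℝ => x.1 i)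
      ((ContinuousLinearMap.proj i).comp (ContinuousLinearMap.fst ℝ (α → ℂ) ℝ)) y :=
      ((ContinuousLinearMap.proj (R := ℝ) i).comp
        (ContinuousLinearMap.fst ℝ (α → ℂ) ℝ)).hasFDerivAt
    have hr := Complex.reCLM.hasFDerivAt.comp y hp
    have hi := Complex.imCLM.hasFDerivAt.comp y hp
    have := (hr.mul hr).add (hi.mul hi)
    refine (this.congr_fderiv ?_)
    ext v
    · simp
      ring
    · simp
  have h2 := HasFDerivAt.fun_sum (u := Finset.univ) fun i _ => h1 i
  have h3 := (Complex.ofRealCLM.hasFDerivAt.comp y h2).const_smul Complex.I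
  have h4 := (Complex.ofRealCLM.hasFDerivAt (x := y.2)).comp y hasFDerivAt_snd
  exact hasFDerivAt_fst.prodMk (h4.add h3)

theorem contDiff_par {α : Type} [Fintype α] {n : WithTop ℕ∞} :
    ContDiff ℝ n (par : (α → ℂ) × ℝ → CSp α) := by
  have h1 : ContDiff ℝ n (fun y : (α → ℂ) × ℝ => sqn y.1) := by
    simp only [sqn, Complex.normSq_apply]
    refine ContDiff.sum fun i _ => ?_
    have hp : ContDiff ℝ n (fun y : (α → ℂ) × ℝ => y.1 i) :=
      ((ContinuousLinearMap.proj (R := ℝ) i).comp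
        (ContinuousLinearMap.fst ℝ (α → ℂ) ℝ)).contDiff
    have hr := Complex.reCLM.contDiff.comp hp
    have hi := Complex.imCLM.contDiff.comp hp
    exact (hr.mul hr).add (hi.mul hi)
  exact contDiff_fst.prodMk ((Complex.ofRealCLM.contDiff.comp contDiff_snd).add
    (contDiff_const.mul (Complex.ofRealCLM.contDiff.comp h1)))

theorem continuous_par {α : Type} [Fintype α] : Continuous (par : (α → ℂ) × ℝ → CSp α) :=
  (contDiff_par (n := 0)).continuous

theorem continuous_coord {α : Type} : Continuous (coord : CSp α → (α → ℂ) × ℝ) := by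
  unfold coord; fun_prop

theorem tendsto_coord {α : Type} [Fintype α] (x : CSp α) :
    Tendsto coord (𝓝[heis α] x) (𝓝 (coord x)) :=
  continuous_coord.continuousAt.tendsto.mono_left nhdsWithin_le_nhds

theorem tendsto_par {α : Type} [Fintype α] {x : CSp α} (hx : x ∈ heis α) :
    Tendsto par (𝓝 (coord x)) (𝓝[heis α] x) := by
  refine tendsto_nhdsWithin_iff.2 ⟨?_, Eventually.of_forall par_mem_heis⟩
  simpa [par_coord hx] using continuous_par.continuousAt.tendsto (x := coord x)

/-! ### Chain rules for CR derivatives and for the class of CR functions. -/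

section deriv

variable {E E' : Type*} [NormedAddCommGroup E] [NormedSpace ℝ E] [NormedSpace ℂ E]
  [IsScalarTower ℝ ℂ E] [NormedAddCommGroup E'] [NormedSpace ℝ E'] [NormedSpace ℂ E']
  [IsScalarTower ℝ ℂ E']

/-- `h` is differentiable along the hypersurface at `x`, and its derivative is the restriction to
the tangent space of the complex linear map `Λ`. -/
def HasCRDeriv (h : CSp (Fin m) → E) (Λ : CSp (Fin m) →L[ℂ] E) (x : CSp (Fin m)) : Prop :=
  HasFDerivAt (𝕜 := ℝ) (fun y => h (par y)) ((Λ.restrictScalars ℝ).comp (dpar x.1)) (coord x)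

theorem HasCRDeriv.comp_left {h : CSp (Fin m) → E} {Λ : CSp (Fin m) →L[ℂ] E} {x : CSp (Fin m)}
    (hh : HasCRDeriv h Λ x) (hx : x ∈ heis (Fin m)) {G : E → E'} {G' : E →L[ℂ] E'}
    (hG : HasFDerivAt G G' (h x)) : HasCRDeriv (fun y => G (h y)) (G'.comp Λ) x := by
  have h1 : HasFDerivAt (𝕜 := ℝ) G (G'.restrictScalars ℝ) (h (par (coord x))) := by
    rw [par_coord hx]; exact hG.restrictScalars ℝ
  exact HasFDerivAt.comp (coord x) h1 hh

theorem HasCRDeriv.clm {h : CSp (Fin m) → E} {Λ : CSp (Fin m) →L[ℂ] E} {x : CSp (Fin m)}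
    (hh : HasCRDeriv h Λ x) (G : E →L[ℂ] E') : HasCRDeriv (fun y => G (h y)) (G.comp Λ) x :=
  HasFDerivAt.comp (coord x) (G.restrictScalars ℝ).hasFDerivAt hh

/-- A map of the ambient space, read in the coordinates of the hypersurface. -/
noncomputable def inCoord (Ψ : CSp (Fin m) → CSp (Fin m)) (y : (Fin m → ℂ) × ℝ) :
    (Fin m → ℂ) × ℝ :=
  coord (Ψ (par y))

/-- Nothing is known about `h` off the hypersurface, so the chain rule has to pass through the
intrinsic coordinates `inCoord Ψ`. Since `Ψ` preserves the hypersurface, `par ∘ inCoord Ψ = Ψ ∘ par`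
locally, and uniqueness of the derivative eliminates the coordinates again. -/
theorem HasCRDeriv.comp_right {Ψ : CSp (Fin m) → CSp (Fin m)} {x : CSp (Fin m)}
    {h : CSp (Fin m) → E} {Λ : CSp (Fin m) →L[ℂ] E} {Ψ' : CSp (Fin m) →L[ℂ] CSp (Fin m)}
    (hh : HasCRDeriv h Λ (Ψ x)) (hx : x ∈ heis (Fin m)) (hΨ : HasFDerivAt Ψ Ψ' x)
    (hmaps : ∀ᶠ x' in 𝓝[heis (Fin m)] x, Ψ x' ∈ heis (Fin m)) :
    HasCRDeriv (fun y => h (Ψ y)) (Λ.comp Ψ') x := by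
  have h1 : HasFDerivAt (𝕜 := ℝ) (fun y => Ψ (par y))
      ((Ψ'.restrictScalars ℝ).comp (dpar x.1)) (coord x) := by
    have : HasFDerivAt (𝕜 := ℝ) Ψ (Ψ'.restrictScalars ℝ) (par (coord x)) := by
      rw [par_coord hx]; exact hΨ.restrictScalars ℝ
    exact HasFDerivAt.comp (coord x) this (hasFDerivAt_par (coord x))
  let cl : CSp (Fin m) →L[ℝ] (Fin m → ℂ) × ℝ :=
    (ContinuousLinearMap.fst ℝ _ _).prod (Complex.reCLM.comp (ContinuousLinearMap.snd ℝ _ _))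
  have h2 : HasFDerivAt (𝕜 := ℝ) (inCoord Ψ)
      (cl.comp ((Ψ'.restrictScalars ℝ).comp (dpar x.1))) (coord x) :=
    HasFDerivAt.comp (coord x) (cl.hasFDerivAt (x := Ψ (par (coord x)))) h1
  have hc : inCoord Ψ (coord x) = coord (Ψ x) := by simp [inCoord, par_coord hx]
  have hev : ∀ᶠ y in 𝓝 (coord x), par (inCoord Ψ y) = Ψ (par y) := by
    filter_upwards [(tendsto_par hx).eventually hmaps] with y hy
    exact par_coord hy
  have h3 : HasFDerivAt (𝕜 := ℝ) (fun y => par (inCoord Ψ y))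
      ((dpar (Ψ x).1).comp (cl.comp ((Ψ'.restrictScalars ℝ).comp (dpar x.1)))) (coord x) := by
    have := hasFDerivAt_par (inCoord Ψ (coord x))
    rw [hc] at this
    have h4 : HasFDerivAt (𝕜 := ℝ) par (dpar (Ψ x).1) (inCoord Ψ (coord x)) := by
      rw [hc]; exact this
    exact HasFDerivAt.comp (coord x) h4 h2
  have h5 := h3.unique (h1.congr_of_eventuallyEq hev)
  have h6 : HasFDerivAt (𝕜 := ℝ) (fun y => h (par y))
      ((Λ.restrictScalars ℝ).comp (dpar (Ψ x).1)) (inCoord Ψ (coord x)) := by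
    rw [hc]; exact hh
  have h7 := HasFDerivAt.comp (coord x) h6 h2
  rw [ContinuousLinearMap.comp_assoc, h5] at h7
  refine h7.congr_of_eventuallyEq ?_
  filter_upwards [hev] with y hy
  simp [hy]

/-- `h` is of class `C²` near `x` along the hypersurface and satisfies the tangential
Cauchy-Riemann equations there. -/
def IsCRAt (h : CSp (Fin m) → E) (x : CSp (Fin m)) : Prop :=
  ContDiffAt ℝ 2 (fun y => h (par y)) (coord x) ∧
    ∀ᶠ x' in 𝓝[heis (Fin m)] x, ∃ Λ, HasCRDeriv h Λ x'

theorem IsCRAt.exists_deriv {h : CSp (Fin m) → E} {x : CSp (Fin m)} (hh : IsCRAt h x)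
    (hx : x ∈ heis (Fin m)) : ∃ Λ, HasCRDeriv h Λ x :=
  hh.2.self_of_nhdsWithin hx

theorem IsCRAt.continuousWithinAt {h : CSp (Fin m) → E} {x : CSp (Fin m)} (hh : IsCRAt h x)
    (hx : x ∈ heis (Fin m)) : ContinuousWithinAt h (heis (Fin m)) x := by
  have h1 := hh.1.continuousAt.tendsto.comp (tendsto_coord x)
  rw [par_coord hx] at h1
  refine h1.congr' ?_
  filter_upwards [self_mem_nhdsWithin] with y hy
  simp [par_coord hy]

theorem IsCRAt.comp_left {h : CSp (Fin m) → E} {x : CSp (Fin m)} (hh : IsCRAt h x)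
    (hx : x ∈ heis (Fin m)) {G : E → E'} (hG : ContDiffAt ℂ 2 G (h x)) :
    IsCRAt (fun y => G (h y)) x := by
  refine ⟨?_, ?_⟩
  · have : ContDiffAt ℝ 2 G (h (par (coord x))) := by
      rw [par_coord hx]; exact hG.restrict_scalars ℝ
    exact this.comp (coord x) hh.1
  · have hd : ∀ᶠ v in 𝓝 (h x), DifferentiableAt ℂ G v := by
      filter_upwards [hG.eventually (by simp)] with v hv
      exact hv.differentiableAt (by simp)
    filter_upwards [hh.2, (hh.continuousWithinAt hx).eventually hd, self_mem_nhdsWithin]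
      with x' ⟨Λ, hΛ⟩ hG' hx'
    exact ⟨_, hΛ.comp_left hx' hG'.hasFDerivAt⟩

theorem IsCRAt.comp_right {Ψ : CSp (Fin m) → CSp (Fin m)} {x : CSp (Fin m)}
    {h : CSp (Fin m) → E} (hh : IsCRAt h (Ψ x)) (hx : x ∈ heis (Fin m))
    (hΨ : ContDiffAt ℂ 2 Ψ x) (hmaps : ∀ᶠ x' in 𝓝[heis (Fin m)] x, Ψ x' ∈ heis (Fin m)) :
    IsCRAt (fun y => h (Ψ y)) x := by
  have ht : Tendsto Ψ (𝓝[heis (Fin m)] x) (𝓝[heis (Fin m)] (Ψ x)) :=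
    tendsto_nhdsWithin_iff.2 ⟨hΨ.continuousAt.tendsto.mono_left nhdsWithin_le_nhds, hmaps⟩
  refine ⟨?_, ?_⟩
  · have hc : inCoord Ψ (coord x) = coord (Ψ x) := by simp [inCoord, par_coord hx]
    have h1 : ContDiffAt ℝ 2 (inCoord Ψ) (coord x) := by
      have h2 : ContDiffAt ℝ 2 Ψ (par (coord x)) := by
        rw [par_coord hx]; exact hΨ.restrict_scalars ℝ
      have h3 : ContDiffAt ℝ 2 (fun y => Ψ (par y)) (coord x) :=
        h2.comp (coord x) contDiff_par.contDiffAt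
      exact h3.fst.prodMk (Complex.reCLM.contDiff.contDiffAt.comp (coord x) h3.snd)
    have h4 : ContDiffAt ℝ 2 (fun y => h (par y)) (inCoord Ψ (coord x)) := by
      rw [hc]; exact hh.1
    refine (h4.comp (coord x) h1).congr_of_eventuallyEq ?_
    filter_upwards [(tendsto_par hx).eventually hmaps] with y hy
    simp [inCoord, par_coord hy]
  · have hd : ∀ᶠ v in 𝓝[heis (Fin m)] x, DifferentiableAt ℂ Ψ v := by
      filter_upwards [(hΨ.eventually (by simp)).filter_mono nhdsWithin_le_nhds] with v hv
      exact hv.differentiableAt (by simp)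
    filter_upwards [ht.eventually hh.2, hd, self_mem_nhdsWithin,
      eventually_eventually_nhdsWithin.2 hmaps] with x' ⟨Λ, hΛ⟩ hG' hx' hm
    exact ⟨_, hΛ.comp_right hx' hG'.hasFDerivAt hm⟩

end deriv

/-! ### The differential operators in terms of the CR derivative -/

theorem HasCRDeriv.dirD_eq {h : CSp (Fin m) → ℂ} {Λ : CSp (Fin m) →L[ℂ] ℂ} {x : CSp (Fin m)}
    (hh : HasCRDeriv h Λ x) (v : (Fin m → ℂ) × ℝ) : dirD h x v = Λ (dpar x.1 v) := by
  have := HasFDerivAt.fderiv hh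
  simp only [coord] at this
  simp [dirD, this]

theorem sum_single_mul (j : Fin m) (c : ℂ) (z : Fin m → ℂ) :
    ∑ i, (Pi.single j c : Fin m → ℂ) i * z i = c * z j := by
  rw [Finset.sum_eq_single j] <;> simp +contextual

theorem map_mk {Λ : CSp (Fin m) →L[ℂ] ℂ} (z : Fin m → ℂ) (w : ℂ) :
    Λ (z, w) = Λ (z, 0) + w * Λ (0, 1) := by
  rw [← smul_eq_mul, ← map_smul, ← map_add]; simp

theorem HasCRDeriv.opT_eq {h : CSp (Fin m) → ℂ} {Λ : CSp (Fin m) →L[ℂ] ℂ} {x : CSp (Fin m)}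
    (hh : HasCRDeriv h Λ x) : opT h x = Λ (0, 1) := by
  simp [opT, hh.dirD_eq, dpar_apply]

theorem HasCRDeriv.pdw_eq {h : CSp (Fin m) → ℂ} {Λ : CSp (Fin m) →L[ℂ] ℂ} {x : CSp (Fin m)}
    (hh : HasCRDeriv h Λ x) : pdw h x = Λ (0, 1) := hh.opT_eq

/-- Moving along `e_j` in the parameters also moves `w`, through `|z|²`. The Wirtinger combination
leaves `Λ(e_j, 0) + i z̄_j Λ(0, 1)`, the field `L_j` doubles the second term, and `pdz` subtracts
it. -/
theorem HasCRDeriv.pdz_eq {h : CSp (Fin m) → ℂ} {Λ : CSp (Fin m) →L[ℂ] ℂ} {x : CSp (Fin m)}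
    (hh : HasCRDeriv h Λ x) (j : Fin m) : pdz j h x = Λ (Pi.single j 1, 0) := by
  have hI : (Pi.single j Complex.I : Fin m → ℂ) = Complex.I • Pi.single j 1 := by
    rw [← Pi.single_smul]; simp
  have h2 : Λ (Complex.I • (Pi.single j 1 : Fin m → ℂ), 0) =
      Complex.I * Λ (Pi.single j 1, 0) := by
    rw [← smul_eq_mul, ← map_smul]; simp
  simp only [pdz, opL, wirt, hh.dirD_eq, hh.opT_eq, dpar_apply, sum_single_mul]
  rw [map_mk, map_mk (Pi.single j Complex.I), hI, h2]
  generalize Λ (0, 1) = b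
  generalize Λ (Pi.single j 1, 0) = a
  obtain ⟨s, t⟩ := x.1 j
  apply Complex.ext <;> simp <;> ring

theorem opL_eq_pdz (j : Fin m) (h : CSp (Fin m) → ℂ) (x : CSp (Fin m)) :
    opL j h x = pdz j h x + 2 * Complex.I * star (x.1 j) * opT h x := by
  simp [pdz]

theorem HasCRDeriv.opL_eq {h : CSp (Fin m) → ℂ} {Λ : CSp (Fin m) →L[ℂ] ℂ} {x : CSp (Fin m)}
    (hh : HasCRDeriv h Λ x) (j : Fin m) :
    opL j h x = Λ (Pi.single j 1, 2 * Complex.I * star (x.1 j)) := by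
  rw [opL_eq_pdz, hh.pdz_eq, hh.opT_eq, map_mk (Pi.single j 1) (2 * _ * _)]

/-- The coefficients of `Λ` must be `pdz j h x` and `pdw h x`. The equation `L̄_j h = 0` is what
makes this `Λ` agree with the real derivative on both real directions of the `j`-th complex
coordinate. -/
theorem exists_hasCRDeriv {h : CSp (Fin m) → ℂ} {x : CSp (Fin m)}
    (hd : DifferentiableAt ℝ (fun y => h (par y)) (coord x)) (hcr : ∀ j, opLbar j h x = 0) :
    ∃ Λ, HasCRDeriv h Λ x := by
  let Λ : CSp (Fin m) →L[ℂ] ℂ :=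
    (∑ j, pdz j h x • (ContinuousLinearMap.proj j).comp (ContinuousLinearMap.fst ℂ (Fin m → ℂ) ℂ))
      + pdw h x • ContinuousLinearMap.snd ℂ (Fin m → ℂ) ℂ
  refine ⟨Λ, hd.hasFDerivAt.congr_fderiv ?_⟩
  set D := fderiv ℝ (fun y => h (par y)) (coord x) with hD
  have hΛ : ∀ z w, Λ (z, w) = ∑ j, pdz j h x * z j + pdw h x * w := by
    intro z w; simp [Λ]
  have key : ∀ j (c : ℂ), D (Pi.single j c, 0) = Λ (dpar x.1 (Pi.single j c, 0)) := by
    intro j c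
    have h1 : D (Pi.single j c, 0) =
        c.re * D (Pi.single j 1, 0) + c.im * D (Pi.single j Complex.I, 0) := by
      rw [← Complex.real_smul, ← Complex.real_smul, ← map_smul, ← map_smul, ← map_add]
      congr 1
      refine Prod.ext ?_ (by simp)
      simp only [Prod.smul_mk, Prod.mk_add_mk, ← Pi.single_smul, ← Pi.single_add]
      congr 1
      apply Complex.ext <;> simp
    have h2 := hcr j
    simp only [opLbar, wirtBar, opT, dirD] at h2
    rw [dpar_apply, hΛ]
    simp only [sum_single_mul]
    have h3 : ∑ i, pdz i h x * (Pi.single j c : Fin m → ℂ) i = c * pdz j h x := by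
      rw [← sum_single_mul j c (fun i => pdz i h x)]; exact Finset.sum_congr rfl fun i _ => mul_comm _ _
    rw [h3]
    simp only [pdz, opL, wirt, pdw, opT, dirD]
    change D _ = _
    change 1 / 2 * (D _ + Complex.I * D _) - Complex.I * x.1 j * D _ = 0 at h2
    change _ = c * (1 / 2 * (D _ - Complex.I * D _) + Complex.I * star (x.1 j) * D _
      - 2 * Complex.I * star (x.1 j) * D _) + D _ * _
    rw [h1]
    generalize D (Pi.single j 1, 0) = A at *
    generalize D (Pi.single j Complex.I, 0) = B at *
    generalize D (0, 1) = T at *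
    -- The CR equation, solved for the derivative along `e_j` in terms of those along `i e_j` and
    -- `u`.
    have hA : A = 2 * Complex.I * x.1 j * T - Complex.I * B := by linear_combination 2 * h2
    rw [hA]
    obtain ⟨s, t⟩ := x.1 j
    obtain ⟨c1, c2⟩ := c
    apply Complex.ext <;> simp <;> ring
  refine ContinuousLinearMap.ext fun v => ?_
  have hv : v = ∑ j, (Pi.single j (v.1 j), (0 : ℝ)) + v.2 • ((0 : Fin m → ℂ), (1 : ℝ)) := by
    refine Prod.ext ?_ ?_
    · simp [Prod.fst_sum, Finset.univ_sum_single]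
    · simp [Prod.snd_sum]
  have hT : D (0, 1) = Λ (dpar x.1 (0, 1)) := by
    rw [dpar_apply, hΛ]; simp [pdw, opT, dirD, D, coord]
  change D v = Λ (dpar x.1 v)
  rw [hv]
  simp only [map_add, map_sum, map_smul, key, hT]
  congr 1
  exact ((Λ.restrictScalars ℝ).map_smul _ _).symm

end CRGauss

namespace CRGauss

/-! ### Projective linear maps fixing the origin -/

section projective

variable {E : Type*} [NormedAddCommGroup E] [NormedSpace ℂ E]

/-- The projective linear map `v ↦ A v / (1 + M v)`. -/
noncomputable def projMap (A : E →L[ℂ] E) (M : E →L[ℂ] ℂ) (v : E) : E := (1 + M v)⁻¹ • A v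

theorem projMap_zero (A : E →L[ℂ] E) (M : E →L[ℂ] ℂ) : projMap A M 0 = 0 := by simp [projMap]

/-- The denominators multiply. Only the inner one has to be nonzero: if the outer one vanishes, both
sides are `0` by the convention `0⁻¹ = 0`. -/
theorem projMap_projMap (A B : E →L[ℂ] E) (M L : E →L[ℂ] ℂ) {v : E} (hv : 1 + M v ≠ 0) :
    projMap B L (projMap A M v) = projMap (B.comp A) (M + L.comp A) v := by
  simp only [projMap, map_smul, smul_smul, _root_.add_apply, ContinuousLinearMap.comp_apply,
    smul_eq_mul]
  congr 1
  have : 1 + (M v + L (A v)) = (1 + M v) * (1 + (1 + M v)⁻¹ * L (A v)) := by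
    field_simp
    ring
  rw [this, mul_inv, mul_comm]

theorem projMap_comp_linear (A B : E →L[ℂ] E) (M : E →L[ℂ] ℂ) (v : E) :
    projMap A M (B v) = projMap (A.comp B) (M.comp B) v := rfl

theorem hasFDerivAt_projMap (A : E →L[ℂ] E) (M : E →L[ℂ] ℂ) {v : E} (hv : 1 + M v ≠ 0) :
    HasFDerivAt (projMap A M)
      ((1 + M v)⁻¹ • A - ((1 + M v)⁻¹ ^ 2) • M.smulRight (A v)) v := by
  have h1 : HasFDerivAt (fun v => 1 + M v) M v := M.hasFDerivAt.const_add 1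
  have h2 := ((hasDerivAt_inv hv).comp_hasFDerivAt v h1).smul A.hasFDerivAt
  refine h2.congr_fderiv ?_
  ext h
  simp [sub_eq_add_neg, smul_smul]

theorem hasFDerivAt_projMap_zero (A : E →L[ℂ] E) (M : E →L[ℂ] ℂ) :
    HasFDerivAt (projMap A M) A 0 := by
  simpa using hasFDerivAt_projMap A M (v := 0) (by simp)

theorem contDiffAt_projMap (A : E →L[ℂ] E) (M : E →L[ℂ] ℂ) {v : E} (hv : 1 + M v ≠ 0)
    {n : WithTop ℕ∞} : ContDiffAt ℂ n (projMap A M) v :=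
  ((contDiffAt_const.add M.contDiff.contDiffAt).inv hv).smul A.contDiff.contDiffAt

/-- A vector `h` in the kernel satisfies `h = (1 + M v)⁻¹ (M h) v`. Applying `M` gives `M h = 0`,
and then `h = 0`. -/
theorem injective_deriv_projMap {A : E →L[ℂ] E} (hA : Function.Injective A) (M : E →L[ℂ] ℂ) {v : E}
    (hv : 1 + M v ≠ 0) : Function.Injective
      ((1 + M v)⁻¹ • A - ((1 + M v)⁻¹ ^ 2) • M.smulRight (A v)) := by
  rw [injective_iff_map_eq_zero]
  intro h hh
  have h0 : (1 + M v)⁻¹ ≠ 0 := inv_ne_zero hv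
  have h1 : A ((1 + M v)⁻¹ • (h - ((1 + M v)⁻¹ * M h) • v)) = 0 := by
    rw [← hh]
    simp only [map_smul, map_sub, _root_.sub_apply, _root_.smul_apply,
      ContinuousLinearMap.smulRight_apply, smul_sub, smul_smul]
    ring_nf
  have h2 := (injective_iff_map_eq_zero A).1 hA _ h1
  have h3 := (smul_eq_zero.1 h2).resolve_left h0
  have h4 : M h = (1 + M v)⁻¹ * M h * M v := by
    have := congrArg M h3
    simpa [sub_eq_zero] using this
  have h5 : M h = 0 := by
    field_simp at h4
    linear_combination h4
  simpa [h5] using h3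

theorem eventually_one_add_ne_zero (M : E →L[ℂ] ℂ) : ∀ᶠ v in 𝓝 (0 : E), 1 + M v ≠ 0 := by
  have : ContinuousAt (fun v => 1 + M v) 0 := by fun_prop
  exact this.eventually_ne (by simp)

/-- For `H = A K / (1 + M K)` and `q = 1 - M A⁻¹ H`, one has `q dφ - φ dq = (1 + M K)⁻² π A dK`,
where `φ = π H`. -/
theorem projMap_quotient_rule {F : Type*} [AddCommGroup F] [Module ℂ F] {A B : E →L[ℂ] E}
    {M : E →L[ℂ] ℂ} (hBA : ∀ v, B (A v) = v) (π : E →ₗ[ℂ] F) {v : E} (hv : 1 + M v ≠ 0) (h : E) :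
    (1 - M (B (projMap A M v))) •
        π (((1 + M v)⁻¹ • A - ((1 + M v)⁻¹ ^ 2) • M.smulRight (A v)) h) +
      M (B (((1 + M v)⁻¹ • A - ((1 + M v)⁻¹ ^ 2) • M.smulRight (A v)) h)) • π (projMap A M v) =
    ((1 + M v)⁻¹ ^ 2) • π (A h) := by
  simp only [projMap, _root_.sub_apply, _root_.smul_apply,
      ContinuousLinearMap.smulRight_apply, map_sub, map_smul, hBA, smul_eq_mul]
  -- So `q` is the reciprocal of the denominator, `φ / q = π A K` is linear in `K`, and the claim is
  -- `q dφ - φ dq = q² d(φ / q)`.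
  have h1 : 1 - (1 + M v)⁻¹ * M v = (1 + M v)⁻¹ := by field_simp; ring
  rw [h1]
  set s := (1 + M v)⁻¹ with hs
  have h2 : s * M v = 1 - s := by linear_combination -h1
  have h3 : s * M h - s ^ 2 * (M h * M v) = s ^ 2 * M h := by
    linear_combination (-(s * M h)) * h2
  rw [h3]
  simp only [smul_sub, smul_smul]
  rw [sub_add]
  have : s * (s ^ 2 * M h) = s ^ 2 * M h * s := by ring
  rw [this]; simp [pow_two]

end projective

/-- Two surjective linear maps that kill the image of an injective linear map of complementary
dimension have the same kernel. -/
theorem ker_eq_ker_of_comp_eq_zero {X Y W : Type*} [AddCommGroup X] [Module ℂ X]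
    [AddCommGroup Y] [Module ℂ Y] [AddCommGroup W] [Module ℂ W] [FiniteDimensional ℂ Y]
    (Λ : X →ₗ[ℂ] Y) (hΛ : Function.Injective Λ) (a b : Y →ₗ[ℂ] W)
    (ha : Function.Surjective a) (hb : Function.Surjective b)
    (hdim : Module.finrank ℂ X + Module.finrank ℂ W = Module.finrank ℂ Y)
    (ha0 : ∀ x, a (Λ x) = 0) (hb0 : ∀ x, b (Λ x) = 0) : LinearMap.ker a = LinearMap.ker b := by
  -- Each kernel contains the range of `Λ` and has the same dimension by rank-nullity.
  have key : ∀ c : Y →ₗ[ℂ] W, Function.Surjective c → (∀ x, c (Λ x) = 0) →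
      LinearMap.range Λ = LinearMap.ker c := by
    intro c hc hc0
    refine Submodule.eq_of_le_of_finrank_eq ?_ ?_
    · rintro _ ⟨x, rfl⟩; exact hc0 x
    · have h1 := c.finrank_range_add_finrank_ker
      rw [LinearMap.range_eq_top.2 hc, finrank_top] at h1
      rw [LinearMap.finrank_range_of_inj hΛ]
      omega
  rw [← key a ha ha0, key b hb hb0]

/-! ### The automorphisms of the hypersurface as projective linear maps -/

section automorphisms

variable {α : Type} [Fintype α]

/-- The linear part `(z, w) ↦ (z, w - 2 i ⟨z, v̄⟩)` of a Heisenberg translation. -/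
noncomputable def transL (v : α → ℂ) : CSp α →L[ℂ] CSp α :=
  LinearMap.toContinuousLinearMap
    { toFun := fun x => (x.1, x.2 - 2 * Complex.I * ∑ i, x.1 i * star (v i))
      map_add' := fun x y => by
        refine Prod.ext rfl ?_
        simp only [Prod.snd_add, Prod.fst_add, Pi.add_apply, add_mul, Finset.sum_add_distrib]
        ring
      map_smul' := fun c x => by
        refine Prod.ext rfl ?_
        simp only [Prod.smul_snd, Prod.smul_fst, Pi.smul_apply, smul_eq_mul, mul_assoc,
          ← Finset.mul_sum, RingHom.id_apply]
        ring }

theorem transL_apply (v : α → ℂ) (x : CSp α) :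
    transL v x = (x.1, x.2 - 2 * Complex.I * ∑ i, x.1 i * star (v i)) := rfl

theorem injective_transL (v : α → ℂ) : Function.Injective (transL v) := by
  rw [injective_iff_map_eq_zero]
  intro x hx
  rw [transL_apply, Prod.mk_eq_zero] at hx
  refine Prod.ext hx.1 ?_
  simpa [hx.1] using hx.2

theorem sum_mul_star_self (z : α → ℂ) : ∑ i, z i * star (z i) = (sqn z : ℂ) := by
  simp [sqn, Complex.mul_conj]

/-- The constant term of `tau0` contains the conjugate of `v.2`. It fits the linear form only for
`v` on the hypersurface, where `v.2 - star v.2 = 2 i |v.1|²`. -/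
theorem tau0_eq {v : CSp α} (hv : v ∈ heis α) (x : CSp α) : tau0 v x = transL v.1 (x - v) := by
  have h : v.2.im = sqn v.1 := hv
  refine Prod.ext rfl ?_
  simp only [tau0, transL_apply, Prod.snd_sub, Prod.fst_sub, Pi.sub_apply, sub_mul,
    Finset.sum_sub_distrib, sum_mul_star_self, ← h]
  have : v.2 - star v.2 = 2 * Complex.I * (v.2.im : ℂ) := by
    apply Complex.ext <;> simp; ring
  linear_combination this

theorem sigma0_eq (p x : CSp α) : sigma0 p x = transL (-p.1) x + p := by
  refine Prod.ext rfl ?_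
  simp only [sigma0, transL_apply, Prod.snd_add, Pi.neg_apply, star_neg, mul_neg,
    Finset.sum_neg_distrib]
  ring

theorem sqn_add (z v : α → ℂ) : sqn (z + v) = sqn z + sqn v + 2 * (∑ i, z i * star (v i)).re := by
  simp only [sqn, Complex.re_sum, Finset.mul_sum, ← Finset.sum_add_distrib]
  refine Finset.sum_congr rfl fun i _ => ?_
  simp [Complex.normSq_add]

theorem sqn_neg (z : α → ℂ) : sqn (-z) = sqn z := by simp [sqn]

theorem sigma0_mem {p x : CSp α} (hp : p ∈ heis α) (hx : x ∈ heis α) : sigma0 p x ∈ heis α := by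
  have h1 : p.2.im = sqn p.1 := hp
  have h2 : x.2.im = sqn x.1 := hx
  change (sigma0 p x).2.im = sqn (x.1 + p.1)
  rw [sqn_add, ← h1, ← h2]
  simp [sigma0]

theorem tau0_mem {p x : CSp α} (hp : p ∈ heis α) (hx : x ∈ heis α) : tau0 p x ∈ heis α := by
  have h1 : p.2.im = sqn p.1 := hp
  have h2 : x.2.im = sqn x.1 := hx
  change (tau0 p x).2.im = sqn (x.1 - p.1)
  rw [sub_eq_add_neg, sqn_add, sqn_neg, ← h1, ← h2]
  simp [tau0]
  ring

/-- The numerator `(z, w) ↦ (z - a w, w)` of `aut a r`. -/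
noncomputable def autA (a : α → ℂ) : CSp α →L[ℂ] CSp α :=
  (ContinuousLinearMap.fst ℂ (α → ℂ) ℂ -
    (ContinuousLinearMap.snd ℂ (α → ℂ) ℂ).smulRight a).prod (ContinuousLinearMap.snd ℂ (α → ℂ) ℂ)

omit [Fintype α] in
theorem autA_apply (a : α → ℂ) (x : CSp α) : autA a x = (x.1 - x.2 • a, x.2) := by
  simp [autA]

omit [Fintype α] in
theorem injective_autA (a : α → ℂ) : Function.Injective (autA a) := by
  rw [injective_iff_map_eq_zero]
  intro x hx
  rw [autA_apply, Prod.mk_eq_zero] at hx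
  refine Prod.ext ?_ hx.2
  simpa [hx.2] using hx.1

/-- The linear part of the denominator of `aut a r`. -/
noncomputable def autM (a : α → ℂ) (r : ℝ) : CSp α →L[ℂ] ℂ :=
  (2 * Complex.I) • (∑ i, star (a i) •
    (ContinuousLinearMap.proj i).comp (ContinuousLinearMap.fst ℂ (α → ℂ) ℂ)) +
  ((r : ℂ) - Complex.I * (sqn a : ℂ)) • ContinuousLinearMap.snd ℂ (α → ℂ) ℂ

theorem autM_apply (a : α → ℂ) (r : ℝ) (x : CSp α) : autM a r x =
    2 * Complex.I * (∑ i, star (a i) * x.1 i) + ((r : ℂ) - Complex.I * (sqn a : ℂ)) * x.2 := by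
  simp [autM]

theorem aut_eq (a : α → ℂ) (r : ℝ) (x : CSp α) : aut a r x = projMap (autA a) (autM a r) x := by
  simp only [aut, projMap, autA_apply, autM_apply, add_assoc]

theorem sqn_smul (c : ℂ) (z : α → ℂ) : sqn (c • z) = Complex.normSq c * sqn z := by
  simp [sqn, Finset.mul_sum]

/-- With denominator `δ`, `Im (w / δ) = |δ|⁻² Im (δ̄ w)`, so the point is that `Im (δ̄ w) = |z - a
w|²`. The parameter `r` contributes only the real number `r |w|²` to `δ̄ w`. -/
theorem aut_mem {a : α → ℂ} {r : ℝ} {x : CSp α} (hx : x ∈ heis α) (h : 1 + autM a r x ≠ 0) :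
    aut a r x ∈ heis α := by
  have h2 : x.2.im = sqn x.1 := hx
  rw [aut_eq]
  change ((1 + autM a r x)⁻¹ * (autA a x).2).im = sqn ((1 + autM a r x)⁻¹ • (autA a x).1)
  rw [sqn_smul, autA_apply, sub_eq_add_neg, sqn_add, sqn_neg, sqn_smul, ← h2]
  set δ := 1 + autM a r x with hδ
  have hsum : ∑ i, x.1 i * star ((-(x.2 • a)) i) = -(star x.2 * ∑ i, star (a i) * x.1 i) := by
    rw [Finset.mul_sum, ← Finset.sum_neg_distrib]
    refine Finset.sum_congr rfl fun i _ => ?_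
    simp; ring
  have h3 : (star δ * x.2).im = x.2.im + Complex.normSq x.2 * sqn a +
      2 * (∑ i, x.1 i * star ((-(x.2 • a)) i)).re := by
    rw [hsum, hδ, autM_apply]
    generalize ∑ i, star (a i) * x.1 i = t
    simp [Complex.normSq_apply]
    ring
  have h4 : δ⁻¹ = (Complex.normSq δ⁻¹ : ℂ) * star δ := by
    rw [Complex.inv_def, Complex.normSq_mul, Complex.normSq_conj, Complex.normSq_ofReal]
    have : Complex.normSq δ ≠ 0 := by simpa using h
    have h5 : Complex.normSq δ * ((Complex.normSq δ)⁻¹ * (Complex.normSq δ)⁻¹) =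
      (Complex.normSq δ)⁻¹ := by field_simp
    rw [h5, mul_comm]; rfl
  rw [← h3, ← Complex.im_ofReal_mul, ← mul_assoc, ← h4]

end automorphisms

end CRGauss

namespace CRGauss

variable {m : ℕ} {ι : Type} [Fintype ι]

/-! ### The change of the source -/

/-- `srcU` as a linear map. -/
noncomputable def srcUL (U : Matrix (Fin m) (Fin m) ℂ) : CSp (Fin m) →L[ℂ] CSp (Fin m) :=
  LinearMap.toContinuousLinearMap (U.vecMulLinear.prodMap LinearMap.id)

theorem isUnit_of_mem_unitaryGroup {κ : Type} [Fintype κ] [DecidableEq κ] {U : Matrix κ κ ℂ}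
    (hU : U ∈ Matrix.unitaryGroup κ ℂ) : IsUnit U :=
  ⟨Unitary.toUnits ⟨U, hU⟩, rfl⟩

theorem injective_srcUL {U : Matrix (Fin m) (Fin m) ℂ}
    (hU : U ∈ Matrix.unitaryGroup (Fin m) ℂ) : Function.Injective (srcUL U) :=
  Function.Injective.prodMap (Matrix.vecMul_injective_of_isUnit (isUnit_of_mem_unitaryGroup hU))
    Function.injective_id

theorem sqn_vecMul {U : Matrix (Fin m) (Fin m) ℂ} (hU : U ∈ Matrix.unitaryGroup (Fin m) ℂ)
    (z : Fin m → ℂ) : sqn (Matrix.vecMul z U) = sqn z := by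
  apply Complex.ofReal_injective
  have h : ∀ v : Fin m → ℂ, (sqn v : ℂ) = v ⬝ᵥ star v := fun v => (sum_mul_star_self v).symm
  rw [h, h, Matrix.star_vecMul, Matrix.dotProduct_mulVec, Matrix.vecMul_vecMul]
  have : U * U.conjTranspose = 1 := Matrix.mem_unitaryGroup_iff.1 hU
  rw [this, Matrix.vecMul_one]

theorem srcU_mem {U : Matrix (Fin m) (Fin m) ℂ} (hU : U ∈ Matrix.unitaryGroup (Fin m) ℂ)
    {x : CSp (Fin m)} (hx : x ∈ heis (Fin m)) : srcU U x ∈ heis (Fin m) := by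
  have h2 : x.2.im = sqn x.1 := hx
  change x.2.im = sqn (Matrix.vecMul x.1 U)
  rw [sqn_vecMul hU, h2]

/-- The derivative of `srcChange` at a point. -/
noncomputable def srcDeriv (p : CSp (Fin m)) (U : Matrix (Fin m) (Fin m) ℂ) (c : Fin m → ℂ)
    (x : CSp (Fin m)) : CSp (Fin m) →L[ℂ] CSp (Fin m) :=
  (transL (-p.1)).comp ((srcUL U).comp ((1 + autM c 0 x)⁻¹ • autA c -
    ((1 + autM c 0 x)⁻¹ ^ 2) • (autM c 0).smulRight (autA c x)))

theorem srcChange_eq (p : CSp (Fin m)) (U : Matrix (Fin m) (Fin m) ℂ) (c : Fin m → ℂ)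
    (x : CSp (Fin m)) : srcChange p U c x =
      ((transL (-p.1)).comp (srcUL U)) (projMap (autA c) (autM c 0) x) + p := by
  rw [srcChange, sigma0_eq, aut_eq]; rfl

theorem srcChange_zero (p : CSp (Fin m)) (U : Matrix (Fin m) (Fin m) ℂ) (c : Fin m → ℂ) :
    srcChange p U c 0 = p := by
  rw [srcChange_eq, projMap_zero, map_zero, zero_add]

theorem hasFDerivAt_srcChange (p : CSp (Fin m)) (U : Matrix (Fin m) (Fin m) ℂ) (c : Fin m → ℂ)
    {x : CSp (Fin m)} (hx : 1 + autM c 0 x ≠ 0) :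
    HasFDerivAt (srcChange p U c) (srcDeriv p U c x) x := by
  rw [funext (srcChange_eq p U c)]
  exact ((((transL (-p.1)).comp (srcUL U)).hasFDerivAt.comp x
    (hasFDerivAt_projMap (autA c) (autM c 0) hx)).add_const p)

theorem contDiffAt_srcChange (p : CSp (Fin m)) (U : Matrix (Fin m) (Fin m) ℂ) (c : Fin m → ℂ)
    {x : CSp (Fin m)} (hx : 1 + autM c 0 x ≠ 0) :
    ContDiffAt ℂ 2 (srcChange p U c) x := by
  rw [funext (srcChange_eq p U c)]
  exact (((transL (-p.1)).comp (srcUL U)).contDiff.contDiffAt.comp x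
    (contDiffAt_projMap (autA c) (autM c 0) hx)).add contDiffAt_const

theorem injective_srcDeriv (p : CSp (Fin m)) {U : Matrix (Fin m) (Fin m) ℂ}
    (hU : U ∈ Matrix.unitaryGroup (Fin m) ℂ) (c : Fin m → ℂ)
    {x : CSp (Fin m)} (hx : 1 + autM c 0 x ≠ 0) : Function.Injective (srcDeriv p U c x) :=
  (injective_transL _).comp ((injective_srcUL hU).comp
    (injective_deriv_projMap (injective_autA c) (autM c 0) hx))

theorem surjective_srcDeriv (p : CSp (Fin m)) {U : Matrix (Fin m) (Fin m) ℂ}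
    (hU : U ∈ Matrix.unitaryGroup (Fin m) ℂ) (c : Fin m → ℂ)
    {x : CSp (Fin m)} (hx : 1 + autM c 0 x ≠ 0) : Function.Surjective (srcDeriv p U c x) :=
  (LinearMap.injective_iff_surjective (f := (srcDeriv p U c x : CSp (Fin m) →ₗ[ℂ] _))).1
    (injective_srcDeriv p hU c hx)

theorem srcChange_mem {p : CSp (Fin m)} (hp : p ∈ heis (Fin m)) {U : Matrix (Fin m) (Fin m) ℂ}
    (hU : U ∈ Matrix.unitaryGroup (Fin m) ℂ) (c : Fin m → ℂ)
    {x : CSp (Fin m)} (hx : 1 + autM c 0 x ≠ 0) (hxh : x ∈ heis (Fin m)) :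
    srcChange p U c x ∈ heis (Fin m) :=
  sigma0_mem hp (srcU_mem hU (aut_mem hxh hx))

theorem eventually_srcChange_mem {p : CSp (Fin m)} (hp : p ∈ heis (Fin m))
    {U : Matrix (Fin m) (Fin m) ℂ} (hU : U ∈ Matrix.unitaryGroup (Fin m) ℂ) (c : Fin m → ℂ) :
    ∀ᶠ x in 𝓝[heis (Fin m)] 0, srcChange p U c x ∈ heis (Fin m) := by
  filter_upwards [(eventually_one_add_ne_zero (autM c 0)).filter_mono nhdsWithin_le_nhds,
    self_mem_nhdsWithin] with x hx hxh
  exact srcChange_mem hp hU c hx hxh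

theorem tendsto_srcChange {p : CSp (Fin m)} (hp : p ∈ heis (Fin m))
    {U : Matrix (Fin m) (Fin m) ℂ} (hU : U ∈ Matrix.unitaryGroup (Fin m) ℂ) (c : Fin m → ℂ) :
    Tendsto (srcChange p U c) (𝓝[heis (Fin m)] 0) (𝓝[heis (Fin m)] p) := by
  refine tendsto_nhdsWithin_iff.2 ⟨?_, eventually_srcChange_mem hp hU c⟩
  have := (contDiffAt_srcChange p U c (x := 0) (by simp)).continuousAt.tendsto
  rw [srcChange_zero] at this
  exact this.mono_left nhdsWithin_le_nhds

/-! ### The renormalized map as a projective linear image of the original map -/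

/-- The linear normalization `(z, w) ↦ (z Ā / √t, w / t)`. -/
noncomputable def nrmL (A : Matrix (Fin m ⊕ ι) (Fin m ⊕ ι) ℂ) (t : ℝ) :
    CSp (Fin m ⊕ ι) →L[ℂ] CSp (Fin m ⊕ ι) :=
  LinearMap.toContinuousLinearMap
    ((((Real.sqrt t : ℂ)⁻¹) • (A.map star).vecMulLinear).prodMap ((t : ℂ)⁻¹ • LinearMap.id))

theorem nrmL_apply (A : Matrix (Fin m ⊕ ι) (Fin m ⊕ ι) ℂ) (t : ℝ) (x : CSp (Fin m ⊕ ι)) :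
    nrmL A t x = (fun k => (∑ i, x.1 i * star (A i k)) / (Real.sqrt t : ℂ), x.2 / (t : ℂ)) := by
  refine Prod.ext ?_ ?_
  · funext k
    simp only [nrmL, LinearMap.coe_toContinuousLinearMap', LinearMap.prodMap_apply,
      LinearMap.smul_apply, Pi.smul_apply, Matrix.vecMulLinear_apply, Matrix.vecMul, dotProduct,
      Matrix.map_apply, smul_eq_mul]
    rw [mul_comm, div_eq_mul_inv]
  · simp [nrmL, div_eq_mul_inv, mul_comm]

theorem isUnit_map_star [DecidableEq ι] {A : Matrix (Fin m ⊕ ι) (Fin m ⊕ ι) ℂ}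
    (hA : A ∈ Matrix.unitaryGroup (Fin m ⊕ ι) ℂ) : IsUnit (A.map star) := by
  have : A.map star = (star A).transpose := by
    rw [Matrix.star_eq_conjTranspose, Matrix.conjTranspose, Matrix.transpose_map,
      Matrix.transpose_transpose]
  rw [this, Matrix.isUnit_transpose]
  exact isUnit_of_mem_unitaryGroup (Unitary.star_mem hA)

theorem injective_nrmL [DecidableEq ι] {A : Matrix (Fin m ⊕ ι) (Fin m ⊕ ι) ℂ}
    (hA : A ∈ Matrix.unitaryGroup (Fin m ⊕ ι) ℂ) {t : ℝ} (ht : 0 < t) :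
    Function.Injective (nrmL A t) := by
  have h1 : ((Real.sqrt t : ℂ)⁻¹) ≠ 0 := by
    simpa using (Real.sqrt_pos.2 ht).ne'
  have h2 : ((t : ℂ)⁻¹) ≠ 0 := by simpa using ht.ne'
  change Function.Injective (Prod.map
    (fun z => (Real.sqrt t : ℂ)⁻¹ • Matrix.vecMul z (A.map star)) (fun w : ℂ => (t : ℂ)⁻¹ • w))
  refine Function.Injective.prodMap ?_ ?_
  · exact (smul_right_injective _ h1).comp
      (Matrix.vecMul_injective_of_isUnit (isUnit_map_star hA))
  · exact smul_right_injective _ h2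

/-- The block map `(f, φ, g) ↦ (f U⁻¹, φ V, g)`. -/
noncomputable def blkL (U : Matrix (Fin m) (Fin m) ℂ) (V : Matrix ι ι ℂ) :
    CSp (Fin m ⊕ ι) →L[ℂ] CSp (Fin m ⊕ ι) :=
  LinearMap.toContinuousLinearMap
    { toFun := fun x => (Sum.elim (Matrix.vecMul (fun l => x.1 (Sum.inl l)) U⁻¹)
        (Matrix.vecMul (fun k => x.1 (Sum.inr k)) V), x.2)
      map_add' := fun x y => by
        refine Prod.ext (funext fun k => ?_) rfl
        cases k
        · exact congrFun (Matrix.add_vecMul U⁻¹ (fun l => x.1 (Sum.inl l))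
            (fun l => y.1 (Sum.inl l))) _
        · exact congrFun (Matrix.add_vecMul V (fun l => x.1 (Sum.inr l))
            (fun l => y.1 (Sum.inr l))) _
      map_smul' := fun c x => by
        refine Prod.ext (funext fun k => ?_) rfl
        cases k
        · exact congrFun (Matrix.smul_vecMul c (fun l => x.1 (Sum.inl l)) U⁻¹) _
        · exact congrFun (Matrix.smul_vecMul c (fun l => x.1 (Sum.inr l)) V) _ }

theorem blkL_apply (U : Matrix (Fin m) (Fin m) ℂ) (V : Matrix ι ι ℂ) (x : CSp (Fin m ⊕ ι)) :
    blkL U V x = (Sum.elim (Matrix.vecMul (fun l => x.1 (Sum.inl l)) U⁻¹)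
        (Matrix.vecMul (fun k => x.1 (Sum.inr k)) V), x.2) := rfl

theorem injective_blkL [DecidableEq ι] {U : Matrix (Fin m) (Fin m) ℂ} {V : Matrix ι ι ℂ}
    (hU : U ∈ Matrix.unitaryGroup (Fin m) ℂ) (hV : V ∈ Matrix.unitaryGroup ι ℂ) :
    Function.Injective (blkL U V) := by
  intro x y hxy
  simp only [blkL_apply, Prod.mk.injEq, Sum.elim_eq_iff] at hxy
  obtain ⟨⟨h1, h2⟩, h3⟩ := hxy
  have hU' : IsUnit U⁻¹ := (Matrix.isUnit_nonsing_inv_iff).2 (isUnit_of_mem_unitaryGroup hU)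
  have h1' := Matrix.vecMul_injective_of_isUnit hU' h1
  have h2' := Matrix.vecMul_injective_of_isUnit (isUnit_of_mem_unitaryGroup hV) h2
  refine Prod.ext (funext fun k => ?_) h3
  cases k with
  | inl l => exact congrFun h1' l
  | inr l => exact congrFun h2' l

section renormalized

variable (F : CSp (Fin m) → CSp (Fin m ⊕ ι)) (p : CSp (Fin m)) (C : ι → Fin m ⊕ ι → ℂ)
  (U : Matrix (Fin m) (Fin m) ℂ) (V : Matrix ι ι ℂ) (c : Fin m → ℂ)

/-- `F_p^*` as a linear image of `F - F p`. -/
noncomputable def linF1 : CSp (Fin m ⊕ ι) →L[ℂ] CSp (Fin m ⊕ ι) :=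
  (nrmL (matA F p C) (lam F p)).comp (transL (F p).1)

/-- The linear part of `F_p^{****}` in terms of `F - F p`. -/
noncomputable def linF4 : CSp (Fin m ⊕ ι) →L[ℂ] CSp (Fin m ⊕ ι) :=
  (autA (Sum.elim (-c) (fun _ => 0))).comp ((blkL U V).comp ((autA (vecA F p C)).comp
    (linF1 F p C)))

/-- The linear part of the denominator of `F_p^{**}`. -/
noncomputable def denF2 : CSp (Fin m ⊕ ι) →L[ℂ] ℂ :=
  (autM (vecA F p C) (numR F p C)).comp (linF1 F p C)

/-- The linear part of the denominator of `F_p^{****}`. -/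
noncomputable def denF4 : CSp (Fin m ⊕ ι) →L[ℂ] ℂ :=
  denF2 F p C + ((autM (Sum.elim (-c) (fun _ => 0)) 0).comp (blkL U V)).comp
    ((autA (vecA F p C)).comp (linF1 F p C))

variable {F p}

theorem Fp_eq (hp : F p ∈ heis (Fin m ⊕ ι)) (x : CSp (Fin m)) :
    Fp F p x = transL (F p).1 (F (sigma0 p x) - F p) := tau0_eq hp _

theorem F1_eq (hp : F p ∈ heis (Fin m ⊕ ι)) (x : CSp (Fin m)) :
    F1 F p C x = linF1 F p C (F (sigma0 p x) - F p) := by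
  rw [F1, linF1, ContinuousLinearMap.comp_apply, ← Fp_eq hp, nrmL_apply]

theorem F3_eq (hp : F p ∈ heis (Fin m ⊕ ι)) (x : CSp (Fin m)) :
    F3 F p C U V x = blkL U V (projMap ((autA (vecA F p C)).comp (linF1 F p C)) (denF2 F p C)
      (F (sigma0 p (srcU U x)) - F p)) := by
  rw [denF2, ← projMap_comp_linear, ← F1_eq C hp, ← aut_eq]; rfl

/-- On the target, the passage from `F` to `F_p^{****}` consists of affine and projective maps
sending `F p` to `0`, so it is a single projective map in `F - F p`; the changes of the source are
collected in `srcChange`. -/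
theorem F4_eq (hp : F p ∈ heis (Fin m ⊕ ι)) (x : CSp (Fin m))
    (hx : 1 + denF2 F p C (F (srcChange p U c x) - F p) ≠ 0) :
    F4 F p C U V c x =
      projMap (linF4 F p C U V c) (denF4 F p C U V c) (F (srcChange p U c x) - F p) := by
  rw [F4, F3_eq C U V hp, aut_eq, projMap_comp_linear]
  exact projMap_projMap _ _ _ _ hx

theorem injective_linF4 [DecidableEq ι] (hC : IsCompletion F p C)
    (hU : U ∈ Matrix.unitaryGroup (Fin m) ℂ) (hV : V ∈ Matrix.unitaryGroup ι ℂ) :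
    Function.Injective (linF4 F p C U V c) :=
  (injective_autA _).comp ((injective_blkL hU hV).comp ((injective_autA _).comp
    ((injective_nrmL hC.2 hC.1).comp (injective_transL _))))

end renormalized

/-! ### The Gauss map equation -/

/-- The linear map whose kernel is the `n`-plane spanned by the rows of `(I G)`. -/
noncomputable def gaussKer (G : Matrix (Fin m ⊕ Unit) ι ℂ) :
    CSp (Fin m ⊕ ι) →ₗ[ℂ] ι → ℂ :=
  LinearMap.pi fun k => LinearMap.proj (Sum.inr k) ∘ₗ LinearMap.fst ℂ _ _ -
    (∑ l, G (Sum.inl l) k • (LinearMap.proj (Sum.inl l) ∘ₗ LinearMap.fst ℂ _ _) +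
      G (Sum.inr ()) k • LinearMap.snd ℂ _ _)

omit [Fintype ι] in
theorem gaussKer_apply (G : Matrix (Fin m ⊕ Unit) ι ℂ) (v : CSp (Fin m ⊕ ι)) (k : ι) :
    gaussKer G v k = v.1 (Sum.inr k) -
      (∑ l, G (Sum.inl l) k * v.1 (Sum.inl l) + G (Sum.inr ()) k * v.2) := by
  simp [gaussKer]

omit [Fintype ι] in
theorem surjective_gaussKer (G : Matrix (Fin m ⊕ Unit) ι ℂ) :
    Function.Surjective (gaussKer G) := by
  intro v
  refine ⟨(Sum.elim 0 v, 0), funext fun k => ?_⟩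
  simp [gaussKer_apply]

/-- The vectors of `ℂ^n` along which the rows of `(P Q)` are the derivatives of `F`. -/
noncomputable def rowVec (x : CSp (Fin m)) : Fin m ⊕ Unit → CSp (Fin m)
  | Sum.inl j => (Pi.single j 1, 2 * Complex.I * star (x.1 j))
  | Sum.inr _ => (0, 1)

theorem HasCRDeriv.rowOp_eq {h : CSp (Fin m) → ℂ} {Λ : CSp (Fin m) →L[ℂ] ℂ} {x : CSp (Fin m)}
    (hh : HasCRDeriv h Λ x) (a : Fin m ⊕ Unit) : rowOp a h x = Λ (rowVec x a) := by
  cases a with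
  | inl j => exact hh.opL_eq j
  | inr _ => exact hh.opT_eq

/-- The vectors `rowVec x a` span `ℂ^n`, being triangular with respect to the standard basis. Hence
a linear condition on the rows of `(P Q)` is a condition on the whole range of the derivative. -/
theorem sum_rowVec (x v : CSp (Fin m)) :
    v = ∑ a, (Sum.elim v.1 (fun _ => v.2 - ∑ j, v.1 j * (2 * Complex.I * star (x.1 j))) a) •
      rowVec x a := by
  simp only [Fintype.sum_sum_type, Sum.elim_inl, Sum.elim_inr, rowVec, Finset.univ_unique,
    Finset.sum_singleton]
  refine Prod.ext ?_ ?_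
  · funext k
    simp [Prod.fst_sum, Pi.single_apply]
  · simp [Prod.snd_sum]

/-- The component `f̃_i` as a linear form. -/
noncomputable def compL {β : Type} (i : β) : CSp β →L[ℂ] ℂ :=
  (ContinuousLinearMap.proj i).comp (ContinuousLinearMap.fst ℂ (β → ℂ) ℂ)

theorem HasCRDeriv.gaussP_eq {F : CSp (Fin m) → CSp (Fin m ⊕ ι)}
    {Λ : CSp (Fin m) →L[ℂ] CSp (Fin m ⊕ ι)} {x : CSp (Fin m)} (hF : HasCRDeriv F Λ x)
    (a b : Fin m ⊕ Unit) : gaussP F x a b =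
      Sum.elim (fun l => (Λ (rowVec x a)).1 (Sum.inl l)) (fun _ => (Λ (rowVec x a)).2) b := by
  cases b with
  | inl l => exact (hF.clm (compL (Sum.inl l))).rowOp_eq a
  | inr _ => exact (hF.clm (ContinuousLinearMap.snd ℂ _ _)).rowOp_eq a

theorem HasCRDeriv.gaussQ_eq {F : CSp (Fin m) → CSp (Fin m ⊕ ι)}
    {Λ : CSp (Fin m) →L[ℂ] CSp (Fin m ⊕ ι)} {x : CSp (Fin m)} (hF : HasCRDeriv F Λ x)
    (a : Fin m ⊕ Unit) (k : ι) : gaussQ F x a k = (Λ (rowVec x a)).1 (Sum.inr k) :=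
  (hF.clm (compL (Sum.inr k))).rowOp_eq a

/-- For invertible `P` the equation is `Q = P G`, and its row `a` says that `gaussKer G` vanishes at
`Λ (rowVec x a)`. The Gauss map thus depends only on the `n`-plane `Λ(ℂ^n)`. -/
theorem HasCRDeriv.gauss_eq_iff {F : CSp (Fin m) → CSp (Fin m ⊕ ι)}
    {Λ : CSp (Fin m) →L[ℂ] CSp (Fin m ⊕ ι)} {x : CSp (Fin m)} (hF : HasCRDeriv F Λ x)
    (hP : IsUnit (gaussP F x).det) (G : Matrix (Fin m ⊕ Unit) ι ℂ) :
    gauss F x = G ↔ ∀ v, gaussKer G (Λ v) = 0 := by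
  have h1 : gauss F x = G ↔ gaussQ F x = gaussP F x * G := by
    constructor
    · rintro rfl
      rw [gauss, ← Matrix.mul_assoc, Matrix.mul_nonsing_inv _ hP, Matrix.one_mul]
    · intro h
      rw [gauss, h, ← Matrix.mul_assoc, Matrix.nonsing_inv_mul _ hP, Matrix.one_mul]
  have h2 : gaussQ F x = gaussP F x * G ↔ ∀ a, gaussKer G (Λ (rowVec x a)) = 0 := by
    rw [← Matrix.ext_iff]
    refine forall_congr' fun a => ?_
    rw [funext_iff]
    refine forall_congr' fun k => ?_
    rw [gaussKer_apply, hF.gaussQ_eq, Matrix.mul_apply, Fintype.sum_sum_type, Pi.zero_apply,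
      sub_eq_zero]
    simp only [hF.gaussP_eq, Sum.elim_inl, Sum.elim_inr, Finset.univ_unique,
      Finset.sum_singleton, mul_comm]
  rw [h1, h2]
  refine ⟨fun h v => ?_, fun h a => h _⟩
  rw [sum_rowVec x v]
  simp only [map_sum, map_smul, h, smul_zero, Finset.sum_const_zero]

/-- A kernel vector, expanded in the `rowVec` basis, is a linear relation between the rows of `P`.
-/
theorem HasCRDeriv.injective {F : CSp (Fin m) → CSp (Fin m ⊕ ι)}
    {Λ : CSp (Fin m) →L[ℂ] CSp (Fin m ⊕ ι)} {x : CSp (Fin m)} (hF : HasCRDeriv F Λ x)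
    (hP : IsUnit (gaussP F x).det) : Function.Injective Λ := by
  rw [injective_iff_map_eq_zero]
  intro v hv
  set s : Fin m ⊕ Unit → ℂ :=
    Sum.elim v.1 (fun _ => v.2 - ∑ j, v.1 j * (2 * Complex.I * star (x.1 j))) with hs
  have h0 : ∑ a, s a • Λ (rowVec x a) = 0 := by
    rw [sum_rowVec x v] at hv
    simpa only [map_sum, map_smul] using hv
  have h1 : Matrix.vecMul s (gaussP F x) = 0 := by
    funext b
    simp only [Matrix.vecMul, dotProduct, hF.gaussP_eq, Pi.zero_apply]
    cases b with
    | inl l =>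
      have := congrFun (congrArg Prod.fst h0) (Sum.inl l)
      simpa [Prod.fst_sum] using this
    | inr _ =>
      have := congrArg Prod.snd h0
      simpa [Prod.snd_sum] using this
  have h2 : s = 0 := by
    apply Matrix.vecMul_injective_of_isUnit ((Matrix.isUnit_iff_isUnit_det _).2 hP)
    simpa using h1
  rw [sum_rowVec x v]
  change ∑ a, s a • rowVec x a = 0
  simp [h2]

end CRGauss

/-! ### CR immersions as CR maps, and the Hessian identity at a point. -/

namespace CRGauss

variable {m : ℕ}

theorem isCRAt_of_isCRImmersion {ι : Type} [Fintype ι] {F : CSp (Fin m) → CSp (Fin m ⊕ ι)}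
    {D : Set (CSp (Fin m))} (hF : IsCRImmersion F D) (hD : IsOpen D) {p : CSp (Fin m)}
    (hp : p ∈ heis (Fin m)) (hpD : p ∈ D) : IsCRAt F p := by
  have hC : ∀ x ∈ heis (Fin m), x ∈ D → ContDiffAt ℝ 2 (fun y => F (par y)) (coord x) := by
    intro x hx hxD
    refine hF.contDiff.contDiffAt ((hD.preimage continuous_par).mem_nhds ?_)
    rw [Set.mem_preimage, par_coord hx]; exact hxD
  refine ⟨hC p hp hpD, ?_⟩
  filter_upwards [mem_nhdsWithin_of_mem_nhds (hD.mem_nhds hpD), self_mem_nhdsWithin] with x hxD hx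
  have hd : DifferentiableAt ℝ (fun y => F (par y)) (coord x) :=
    (hC x hx hxD).differentiableAt (by simp)
  have h1 : ∀ k, ∃ Λ, HasCRDeriv (fun y => (F y).1 k) Λ x := fun k =>
    exists_hasCRDeriv ((compL (β := Fin m ⊕ ι) k).restrictScalars ℝ |>.differentiableAt.comp _ hd)
      fun j => hF.cr_tilde x ⟨hx, hxD⟩ j k
  have h2 : ∃ Λ, HasCRDeriv (fun y => (F y).2) Λ x :=
    exists_hasCRDeriv ((ContinuousLinearMap.snd ℝ (Fin m ⊕ ι → ℂ) ℂ).differentiableAt.comp _ hd)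
      fun j => hF.cr_g x ⟨hx, hxD⟩ j
  choose Λ1 hΛ1 using h1
  obtain ⟨Λ2, hΛ2⟩ := h2
  refine ⟨(ContinuousLinearMap.pi Λ1).prod Λ2, ?_⟩
  exact (hasFDerivAt_pi.2 hΛ1).prodMk hΛ2

/-! ### Second order consequences of mapping the hypersurface into the hypersurface -/

section hessian

variable {α : Type} [Fintype α] {K : CSp (Fin m) → CSp α}

omit [Fintype α] in
-- The tangential CR equation in the direction `ζ`: complex linearity cancels the `z`-part and
-- leaves the increment of `w`. Its coefficient depends on `z` and vanishes at `0`; differentiating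
-- it there produces the Levi form of the source.
theorem antiholomorphic_deriv {Λ : CSp (Fin m) →L[ℂ] CSp α} (z ζ : Fin m → ℂ) :
    (Λ (dpar z (ζ, 0))).2 + Complex.I * (Λ (dpar z (Complex.I • ζ, 0))).2 =
      2 * Complex.I * (∑ k, star (ζ k) * z k) * (Λ (dpar z (0, 1))).2 := by
  have h : ∀ c, (Λ (c • (0, 1))).2 = c * (Λ (0, 1)).2 := fun c => by rw [map_smul]; rfl
  have h1 : dpar z (ζ, 0) + Complex.I • dpar z (Complex.I • ζ, 0) =
      (2 * Complex.I * ∑ k, star (ζ k) * z k) • (0, 1) := by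
    simp only [dpar_apply]
    refine Prod.ext ?_ ?_
    · simp [smul_smul]
    · have h2 : ∑ k, star (ζ k) * z k = star (∑ i, ζ i * star (z i)) := by
        simp
      have h3 : ∑ i, (Complex.I • ζ) i * star (z i) = Complex.I * ∑ i, ζ i * star (z i) := by
        simp [Finset.mul_sum, mul_assoc]
      rw [h2, h3]
      generalize ∑ i, ζ i * star (z i) = t
      apply Complex.ext <;> simp
  have h4 : dpar z (0, 1) = (0, 1) := by simp [dpar_apply]
  rw [h4, ← h, ← h1, map_add, map_smul]
  rfl

/-- The differential of `Im w = |z|²` along `k`, obtained by differentiating `k = par ∘ coord ∘ k`.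
-/
theorem deriv_tangent {k : (Fin m → ℂ) × ℝ → CSp α} {k' : (Fin m → ℂ) × ℝ →L[ℝ] CSp α}
    {y : (Fin m → ℂ) × ℝ} (hk : HasFDerivAt k k' y) (hmem : ∀ᶠ x in 𝓝 y, k x ∈ heis α)
    (v : (Fin m → ℂ) × ℝ) :
    (k' v).2.im = 2 * (∑ i, (k' v).1 i * star ((k y).1 i)).re := by
  let cl : CSp α →L[ℝ] (α → ℂ) × ℝ :=
    (ContinuousLinearMap.fst ℝ _ _).prod (Complex.reCLM.comp (ContinuousLinearMap.snd ℝ _ _))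
  have h1 : HasFDerivAt (𝕜 := ℝ) (fun x => par (coord (k x)))
      ((dpar (k y).1).comp (cl.comp k')) y := by
    have h2 : HasFDerivAt (𝕜 := ℝ) (fun x => coord (k x)) (cl.comp k') y :=
      HasFDerivAt.comp y (cl.hasFDerivAt (x := k y)) hk
    exact HasFDerivAt.comp y (hasFDerivAt_par (coord (k y))) h2
  have h3 := h1.unique (hk.congr_of_eventuallyEq (by
    filter_upwards [hmem] with x hx
    exact par_coord hx))
  have h4 := congrArg (fun L : (Fin m → ℂ) × ℝ →L[ℝ] CSp α => (L v).2.im) h3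
  simp only [ContinuousLinearMap.comp_apply, dpar_apply] at h4
  rw [← h4]
  simp [cl]

/-- The last conclusion compares the Levi forms of source and target. With `B` the Hessian of `K` in
the parameters at `0`, differentiating `Im w = |z|²` twice gives `Im (B v v).2 = 2 |(dK v).1|²`.
Differentiating the CR equation once and adding the directions `ζ` and `i ζ` gives `(B ζ ζ + B (iζ)
(iζ)).2 = 4 i |ζ|² (Λ (0, 1)).2`. Taking imaginary parts yields the claim with two derivatives only.
-/
theorem second_order_identity (hK : IsCRAt K 0) (hK0 : K 0 = 0)
    (hmem : ∀ᶠ x in 𝓝[heis (Fin m)] 0, K x ∈ heis α) {Λ : CSp (Fin m) →L[ℂ] CSp α}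
    (hΛ : HasCRDeriv K Λ 0) :
    (Λ (0, 1)).2.im = 0 ∧ (∀ ζ, (Λ (ζ, 0)).2 = 0) ∧
      ∀ ζ, sqn (Λ (ζ, 0)).1 = (Λ (0, 1)).2.re * sqn ζ := by
  set k : (Fin m → ℂ) × ℝ → CSp α := fun y => K (par y) with hk
  have hpar0 : par (0 : (Fin m → ℂ) × ℝ) = 0 := par_coord (x := (0 : CSp (Fin m))) zero_mem_heis
  have hk0 : k 0 = 0 := by simp [hk, hpar0, hK0]
  have hkC : ContDiffAt ℝ 2 k 0 := hK.1
  have ht : Tendsto par (𝓝 (0 : (Fin m → ℂ) × ℝ)) (𝓝[heis (Fin m)] 0) :=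
    tendsto_par (x := (0 : CSp (Fin m))) zero_mem_heis
  have hkmem : ∀ᶠ y in 𝓝 0, k y ∈ heis α := ht.eventually hmem
  have hdiff : ∀ᶠ y in 𝓝 0, DifferentiableAt ℝ k y := by
    filter_upwards [hkC.eventually (by simp)] with y hy
    exact hy.differentiableAt (by simp)
  have hD0 : fderiv ℝ k 0 = (Λ.restrictScalars ℝ).comp (dpar 0) := HasFDerivAt.fderiv hΛ
  have hDv : ∀ v, fderiv ℝ k 0 v = Λ (v.1, (v.2 : ℂ)) := by
    intro v; rw [hD0]; simp [dpar_apply]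
  have hT1 : ∀ᶠ y in 𝓝 0, ∀ v,
      (fderiv ℝ k y v).2.im = 2 * (∑ i, (fderiv ℝ k y v).1 i * star ((k y).1 i)).re := by
    filter_upwards [hdiff, eventually_eventually_nhds.2 hkmem] with y hy1 hy2 v
    exact deriv_tangent hy1.hasFDerivAt hy2 v
  have hIm0 : ∀ v, (fderiv ℝ k 0 v).2.im = 0 := by
    intro v
    rw [hT1.self_of_nhds v, hk0]; simp
  have hCR : ∀ᶠ y in 𝓝 0, ∀ ζ, (fderiv ℝ k y (ζ, 0)).2 +
      Complex.I * (fderiv ℝ k y (Complex.I • ζ, 0)).2 =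
      2 * Complex.I * (∑ k, star (ζ k) * y.1 k) * (fderiv ℝ k y (0, 1)).2 := by
    filter_upwards [ht.eventually hK.2] with y ⟨Λ', hΛ'⟩ ζ
    have h1 : fderiv ℝ k y = (Λ'.restrictScalars ℝ).comp (dpar y.1) := by
      have := HasFDerivAt.fderiv hΛ'
      rwa [coord_par] at this
    rw [h1]
    exact antiholomorphic_deriv y.1 ζ
  have him1 : (Λ (0, 1)).2.im = 0 := by simpa [hDv] using hIm0 (0, 1)
  refine ⟨him1, ?_, ?_⟩
  · intro ζ
    have h1 : (Λ (ζ, 0)).2.im = 0 := by simpa [hDv] using hIm0 (ζ, 0)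
    have h2 : (Λ (Complex.I • ζ, 0)).2.im = 0 := by simpa [hDv] using hIm0 (Complex.I • ζ, 0)
    have h3 : Λ (Complex.I • ζ, 0) = Complex.I • Λ (ζ, 0) := by rw [← map_smul]; simp
    rw [h3] at h2
    -- The form `ζ ↦ (Λ (ζ, 0)).2` is complex linear and real valued at both `ζ` and `i ζ`, hence
    -- zero.
    refine Complex.ext ?_ h1
    simpa using h2
  · intro ζ
    have hD1 : DifferentiableAt ℝ (fderiv ℝ k) 0 :=
      (hkC.fderiv_right (m := 1) (by norm_num)).differentiableAt (by simp)
    set B := fderiv ℝ (fderiv ℝ k) 0 with hB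
    have hsymm : ∀ v w, B v w = B w v := by
      have : IsSymmSndFDerivAt ℝ k 0 := hkC.isSymmSndFDerivAt (by simp)
      exact fun v w => this.eq v w
    have hcomp : ∀ v, HasFDerivAt (fun y => fderiv ℝ k y v) (B.flip v) 0 := fun v =>
      ((ContinuousLinearMap.apply ℝ (CSp α) v).hasFDerivAt.comp (0 : (Fin m → ℂ) × ℝ)
        hD1.hasFDerivAt).congr_fderiv (by ext <;> simp [hB])
    have hcomp2 : ∀ v, HasFDerivAt (𝕜 := ℝ) (fun y => (fderiv ℝ k y v).2)
        ((ContinuousLinearMap.snd ℝ _ _).comp (B.flip v)) 0 := fun v =>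
      HasFDerivAt.comp (0 : (Fin m → ℂ) × ℝ)
        (ContinuousLinearMap.snd ℝ (α → ℂ) ℂ).hasFDerivAt (hcomp v)
    have hk' : HasFDerivAt k (fderiv ℝ k 0) 0 := hdiff.self_of_nhds.hasFDerivAt
    -- the Hessian on the diagonal
    have hdiag : ∀ v, (B v v).2.im = 2 * sqn (fderiv ℝ k 0 v).1 := by
      intro v
      have h1 : HasFDerivAt (𝕜 := ℝ) (fun y => (fderiv ℝ k y v).2.im)
          (Complex.imCLM.comp ((ContinuousLinearMap.snd ℝ _ _).comp (B.flip v))) 0 :=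
        HasFDerivAt.comp (0 : (Fin m → ℂ) × ℝ) Complex.imCLM.hasFDerivAt (hcomp2 v)
      -- The other term of the product rule carries the factor `k 0 = 0`.
      have h2 : ∀ i, HasFDerivAt (𝕜 := ℝ)
          (fun y => (fderiv ℝ k y v).1 i * star ((k y).1 i))
          ((fderiv ℝ k 0 v).1 i • (Complex.conjCLE.toContinuousLinearMap.comp
            (((compL i).restrictScalars ℝ).comp (fderiv ℝ k 0)))) 0 := by
        intro i
        have h3 : HasFDerivAt (𝕜 := ℝ) (fun y => (fderiv ℝ k y v).1 i)
            (((compL i).restrictScalars ℝ).comp (B.flip v)) 0 :=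
          HasFDerivAt.comp (0 : (Fin m → ℂ) × ℝ)
            ((compL (β := α) i).restrictScalars ℝ).hasFDerivAt (hcomp v)
        have h4 : HasFDerivAt (𝕜 := ℝ) (fun y => star ((k y).1 i))
            (Complex.conjCLE.toContinuousLinearMap.comp
              (((compL i).restrictScalars ℝ).comp (fderiv ℝ k 0))) 0 :=
          HasFDerivAt.comp (0 : (Fin m → ℂ) × ℝ)
            (Complex.conjCLE.toContinuousLinearMap.hasFDerivAt)
            (HasFDerivAt.comp (0 : (Fin m → ℂ) × ℝ)
              ((compL (β := α) i).restrictScalars ℝ).hasFDerivAt hk')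
        refine (h3.mul h4).congr_fderiv (ContinuousLinearMap.ext fun w => ?_)
        simp [hk0]
      have h5 := (HasFDerivAt.comp (0 : (Fin m → ℂ) × ℝ) Complex.reCLM.hasFDerivAt
        (HasFDerivAt.fun_sum (u := Finset.univ) fun i _ => h2 i)).const_mul (2 : ℝ)
      have h6 := h1.unique (h5.congr_of_eventuallyEq (by
        filter_upwards [hT1] with y hy
        exact hy v))
      have h7 := congrArg (fun L : (Fin m → ℂ) × ℝ →L[ℝ] ℝ => L v) h6
      change (B v v).2.im = _ at h7
      rw [h7]
      simp only [_root_.smul_apply, ContinuousLinearMap.comp_apply, _root_.sum_apply,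
        Complex.reCLM_apply, smul_eq_mul]
      congr 1
      have h8 := congrArg Complex.re (sum_mul_star_self (fderiv ℝ k 0 v).1)
      rw [Complex.ofReal_re] at h8
      rw [← h8]
      rfl
    -- the Cauchy-Riemann equations on the Hessian
    have hB2 : ∀ w : (Fin m → ℂ) × ℝ, (B w (ζ, 0)).2 + Complex.I * (B w (Complex.I • ζ, 0)).2 =
        2 * Complex.I * (∑ k, star (ζ k) * w.1 k) * (Λ (0, 1)).2 := by
      intro w
      have h1 := (hcomp2 (ζ, 0)).add ((hcomp2 (Complex.I • ζ, 0)).const_mul Complex.I)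
      let ℓ : (Fin m → ℂ) × ℝ →L[ℝ] ℂ := ∑ k, (star (ζ k)) •
        ((ContinuousLinearMap.proj k).comp (ContinuousLinearMap.fst ℝ (Fin m → ℂ) ℝ))
      have hℓ : ∀ y, ℓ y = ∑ k, star (ζ k) * y.1 k := by intro y; simp [ℓ]
      have h2 := ((ℓ.hasFDerivAt (x := 0)).const_mul (2 * Complex.I)).mul (hcomp2 (0, 1))
      have h3 := h1.unique (h2.congr_of_eventuallyEq (by
        filter_upwards [hCR] with y hy
        simp only [Pi.add_apply, Pi.mul_apply]
        rw [hy ζ, hℓ]))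
      have h4 := congrArg (fun L : (Fin m → ℂ) × ℝ →L[ℝ] ℂ => L w) h3
      change (B w (ζ, 0)).2 + Complex.I * (B w (Complex.I • ζ, 0)).2 = _ at h4
      rw [h4]
      simp [hℓ, hDv]
      ring
    have e1 := hB2 (ζ, 0)
    have e2 := hB2 (Complex.I • ζ, 0)
    have hs : ∑ k, star (ζ k) * ζ k = (sqn ζ : ℂ) := by
      rw [← sum_mul_star_self]; exact Finset.sum_congr rfl fun i _ => mul_comm _ _
    have hs2 : ∑ k, star (ζ k) * (Complex.I • ζ) k = Complex.I * (sqn ζ : ℂ) := by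
      rw [← hs, Finset.mul_sum]
      refine Finset.sum_congr rfl fun i _ => ?_
      simp; ring
    simp only [hs, hs2] at e1 e2
    -- Symmetry of the Hessian makes the mixed terms of `e1` and `e2` cancel in `e1 - i e2`.
    rw [hsymm (Complex.I • ζ, 0) (ζ, 0)] at e2
    have e3 : (B (ζ, 0) (ζ, 0)).2 + (B (Complex.I • ζ, 0) (Complex.I • ζ, 0)).2 =
        4 * Complex.I * (sqn ζ : ℂ) * (Λ (0, 1)).2 := by
      linear_combination e1 - Complex.I * e2 + (B (Complex.I • ζ, 0) (Complex.I • ζ, 0)).2 *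
        Complex.I_sq - 2 * Complex.I * (sqn ζ : ℂ) * (Λ (0, 1)).2 * Complex.I_sq
    have e4 := congrArg Complex.im e3
    rw [Complex.add_im, hdiag, hdiag, hDv, hDv] at e4
    have h3 : Λ (Complex.I • ζ, 0) = Complex.I • Λ (ζ, 0) := by rw [← map_smul]; simp
    simp only [Complex.ofReal_zero, h3, Prod.smul_fst, sqn_smul, Complex.normSq_I] at e4
    have e5 : (4 * Complex.I * (sqn ζ : ℂ) * (Λ (0, 1)).2).im = 4 * (sqn ζ * (Λ (0, 1)).2.re) := by
      simp [Complex.mul_im]; ring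
    rw [e5] at e4
    linarith

end hessian

end CRGauss

namespace CRGauss

variable {m : ℕ} {ι : Type} [Fintype ι]

/-! ### The normalization -/

theorem sqn_eq_norm_sq {α : Type} [Fintype α] (v : α → ℂ) :
    sqn v = ‖(WithLp.toLp 2 v : EuclideanSpace ℂ α)‖ ^ 2 := by
  rw [EuclideanSpace.norm_sq_eq]
  simp [sqn, Complex.normSq_eq_norm_sq]

/-- A linear map that scales `|·|²` by `t > 0` sends the standard basis to `√t` times the first
columns of a unitary matrix. -/
theorem exists_unitary_completion [DecidableEq ι] (T : (Fin m → ℂ) →ₗ[ℂ] (Fin m ⊕ ι → ℂ)) {t : ℝ}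
    (ht : 0 < t) (hT : ∀ ζ, sqn (T ζ) = t * sqn ζ) :
    ∃ C : ι → Fin m ⊕ ι → ℂ, (Matrix.of fun i k => match k with
      | Sum.inl l => T (Pi.single l 1) i / (Real.sqrt t : ℂ)
      | Sum.inr l => C l i : Matrix (Fin m ⊕ ι) (Fin m ⊕ ι) ℂ) ∈
        Matrix.unitaryGroup (Fin m ⊕ ι) ℂ := by
  let S : EuclideanSpace ℂ (Fin m) →ₗ[ℂ] EuclideanSpace ℂ (Fin m ⊕ ι) :=
    (WithLp.linearEquiv 2 ℂ _).symm.toLinearMap ∘ₗ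
      ((Real.sqrt t : ℂ)⁻¹ • T) ∘ₗ (WithLp.linearEquiv 2 ℂ _).toLinearMap
  have hSapp : ∀ v, S v = WithLp.toLp 2 ((Real.sqrt t : ℂ)⁻¹ • T v.ofLp) := fun v => rfl
  have hSn : ∀ v, ‖S v‖ = ‖v‖ := by
    intro v
    rw [← sq_eq_sq₀ (norm_nonneg _) (norm_nonneg _), hSapp, ← sqn_eq_norm_sq, sqn_smul, hT]
    have h1 : ‖v‖ ^ 2 = sqn v.ofLp := (sqn_eq_norm_sq v.ofLp).symm
    rw [h1, ← Complex.ofReal_inv, Complex.normSq_ofReal, ← mul_assoc]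
    have h2 : (Real.sqrt t)⁻¹ * (Real.sqrt t)⁻¹ * t = 1 := by
      rw [← mul_inv, Real.mul_self_sqrt ht.le, inv_mul_cancel₀ ht.ne']
    rw [h2, one_mul]
  let Si : EuclideanSpace ℂ (Fin m) →ₗᵢ[ℂ] EuclideanSpace ℂ (Fin m ⊕ ι) := ⟨S, hSn⟩
  have ho : Orthonormal ℂ (Si ∘ EuclideanSpace.basisFun (Fin m) ℂ) :=
    (EuclideanSpace.basisFun (Fin m) ℂ).orthonormal.comp_linearIsometry Si
  let v : Fin m ⊕ ι → EuclideanSpace ℂ (Fin m ⊕ ι) :=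
    Sum.elim (Si ∘ EuclideanSpace.basisFun (Fin m) ℂ) 0
  have hv : Orthonormal ℂ ((Set.range (Sum.inl : Fin m → Fin m ⊕ ι)).domRestrict v) := by
    have h1 := ho.comp (Equiv.ofInjective (Sum.inl : Fin m → Fin m ⊕ ι) Sum.inl_injective).symm
      (Equiv.injective _)
    convert h1 using 1
    funext ⟨_, l, rfl⟩
    simp [v, Set.domRestrict, Equiv.ofInjective_symm_apply]
  obtain ⟨b, hb⟩ := hv.exists_orthonormalBasis_extension_of_card_eq (by simp)
  refine ⟨fun l i => b (Sum.inr l) i, ?_⟩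
  have hA : (Matrix.of fun i k => match k with
      | Sum.inl l => T (Pi.single l 1) i / (Real.sqrt t : ℂ)
      | Sum.inr l => b (Sum.inr l) i : Matrix (Fin m ⊕ ι) (Fin m ⊕ ι) ℂ) =
      Matrix.of fun i k => b k i := by
    ext i k
    cases k with
    | inl l =>
      have h1 : b (Sum.inl l) = S (EuclideanSpace.basisFun (Fin m) ℂ l) := hb _ ⟨l, rfl⟩
      have h2 : b (Sum.inl l) i = (Real.sqrt t : ℂ)⁻¹ * T (Pi.single l 1) i := by
        rw [h1, hSapp]; simp
      simp only [Matrix.of_apply, h2]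
      rw [mul_comm, div_eq_mul_inv]
    | inr l => rfl
  rw [hA, Matrix.mem_unitaryGroup_iff']
  ext k l
  have h1 := orthonormal_iff_ite.1 b.orthonormal k l
  rw [Matrix.one_apply, ← h1, Matrix.mul_apply, PiLp.inner_apply]
  refine Finset.sum_congr rfl fun i _ => ?_
  simp [mul_comm]

/-! ### First-order data of the renormalized maps. -/

section normalization

variable {F : CSp (Fin m) → CSp (Fin m ⊕ ι)} {p : CSp (Fin m)}

theorem isCRAt_comp_sigma0 (hF : IsCRAt F p) (hp : p ∈ heis (Fin m)) :
    IsCRAt (fun x => F (sigma0 p x)) 0 := by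
  have h0 : sigma0 p 0 = p := by rw [sigma0_eq, map_zero, zero_add]
  have hC : ContDiffAt ℂ 2 (sigma0 p) 0 := by
    rw [funext (sigma0_eq p)]
    exact (transL (-p.1)).contDiff.contDiffAt.add contDiffAt_const
  refine IsCRAt.comp_right (by rwa [h0]) zero_mem_heis hC ?_
  filter_upwards [self_mem_nhdsWithin] with x hx
  exact sigma0_mem hp hx

theorem HasCRDeriv.comp_sigma0 {Λ : CSp (Fin m) →L[ℂ] CSp (Fin m ⊕ ι)} (hF : HasCRDeriv F Λ p)
    (hp : p ∈ heis (Fin m)) :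
    HasCRDeriv (fun x => F (sigma0 p x)) (Λ.comp (transL (-p.1))) 0 := by
  have h0 : sigma0 p 0 = p := by rw [sigma0_eq, map_zero, zero_add]
  have hC : HasFDerivAt (sigma0 p) (transL (-p.1)) 0 := by
    rw [funext (sigma0_eq p)]
    exact (transL (-p.1)).hasFDerivAt.add_const p
  refine HasCRDeriv.comp_right (by rwa [h0]) zero_mem_heis hC ?_
  filter_upwards [self_mem_nhdsWithin] with x hx
  exact sigma0_mem hp hx

theorem HasCRDeriv.sub_const {E : Type*} [NormedAddCommGroup E] [NormedSpace ℝ E] [NormedSpace ℂ E]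
    [IsScalarTower ℝ ℂ E] {h : CSp (Fin m) → E} {Λ : CSp (Fin m) →L[ℂ] E} {x : CSp (Fin m)}
    (hh : HasCRDeriv h Λ x) (a : E) : HasCRDeriv (fun y => h y - a) Λ x :=
  HasFDerivAt.sub_const a hh

/-- The real tangent space contains `(0, 1)` and together with its complex multiples spans `ℂ^n`, so
it determines a complex linear map. -/
theorem HasCRDeriv.unique {E : Type*} [NormedAddCommGroup E] [NormedSpace ℝ E] [NormedSpace ℂ E]
    [IsScalarTower ℝ ℂ E] {h : CSp (Fin m) → E} {Λ Λ' : CSp (Fin m) →L[ℂ] E} {x : CSp (Fin m)}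
    (hh : HasCRDeriv h Λ x) (hh' : HasCRDeriv h Λ' x) : Λ = Λ' := by
  have e : ∀ v, Λ (dpar x.1 v) = Λ' (dpar x.1 v) := fun v =>
    congrArg (fun L : (Fin m → ℂ) × ℝ →L[ℝ] E => L v) (HasFDerivAt.unique hh hh')
  have e1 : Λ (0, 1) = Λ' (0, 1) := by simpa [dpar_apply] using e (0, 1)
  refine ContinuousLinearMap.ext fun v => ?_
  have hv : v = dpar x.1 (v.1, 0) + (v.2 - (dpar x.1 (v.1, 0)).2) • (0, 1) := by
    refine Prod.ext ?_ ?_ <;> simp [dpar_apply]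
  rw [hv, map_add, map_add, map_smul, map_smul, e, e1]

variable {Λ : CSp (Fin m) →L[ℂ] CSp (Fin m ⊕ ι)}

theorem HasCRDeriv.Fp (hF : HasCRDeriv F Λ p) (hp : p ∈ heis (Fin m))
    (hFp : F p ∈ heis (Fin m ⊕ ι)) :
    HasCRDeriv (Fp F p) ((transL (F p).1).comp (Λ.comp (transL (-p.1)))) 0 := by
  rw [funext (Fp_eq hFp)]
  exact ((hF.comp_sigma0 hp).sub_const (F p)).clm (transL (F p).1)

theorem isCRAt_Fp (hF : IsCRAt F p) (hp : p ∈ heis (Fin m)) (hFp : F p ∈ heis (Fin m ⊕ ι)) :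
    IsCRAt (Fp F p) 0 := by
  rw [funext (Fp_eq hFp)]
  exact (isCRAt_comp_sigma0 hF hp).comp_left (G := fun v => transL (F p).1 (v - F p)) zero_mem_heis
    ((transL (F p).1).contDiff.contDiffAt.comp _ (contDiffAt_id.sub contDiffAt_const))

/-- The first order data of `F_p` at `0`. -/
theorem Fp_first_order (hF : IsCRAt F p) (hp : p ∈ heis (Fin m))
    (hmem : ∀ᶠ x in 𝓝[heis (Fin m)] p, F x ∈ heis (Fin m ⊕ ι)) :
    ∃ Λ, HasCRDeriv (Fp F p) Λ 0 ∧ (∀ l, vecE F p l = (Λ (Pi.single l 1, 0)).1) ∧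
      (Λ (0, 1)).2 = (lam F p : ℂ) ∧ (∀ ζ, (Λ (ζ, 0)).2 = 0) ∧
      ∀ ζ, sqn (Λ (ζ, 0)).1 = lam F p * sqn ζ := by
  have hFp : F p ∈ heis (Fin m ⊕ ι) := hmem.self_of_nhdsWithin hp
  obtain ⟨Λ, hΛ⟩ := hF.exists_deriv hp
  have hd := hΛ.Fp hp hFp
  set Λ' := (transL (F p).1).comp (Λ.comp (transL (-p.1))) with hΛ'
  have h0 : sigma0 p 0 = p := by rw [sigma0_eq, map_zero, zero_add]
  have ht : Tendsto (sigma0 p) (𝓝[heis (Fin m)] 0) (𝓝[heis (Fin m)] p) := by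
    refine tendsto_nhdsWithin_iff.2 ⟨?_, ?_⟩
    · have hc : ContinuousAt (sigma0 p) 0 := by
        rw [funext (sigma0_eq p)]
        exact ((transL (-p.1)).continuous.add continuous_const).continuousAt
      have := hc.tendsto
      rw [h0] at this
      exact this.mono_left nhdsWithin_le_nhds
    · filter_upwards [self_mem_nhdsWithin] with x hx
      exact sigma0_mem hp hx
  have hm : ∀ᶠ x in 𝓝[heis (Fin m)] 0, Fp F p x ∈ heis (Fin m ⊕ ι) := by
    filter_upwards [ht.eventually hmem] with x hx
    exact tau0_mem hFp hx
  obtain ⟨h1, h2, h3⟩ := second_order_identity (isCRAt_Fp hF hp hFp)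
    (by rw [Fp_eq hFp, h0, sub_self, map_zero]) hm hd
  have hlam : (Λ' (0, 1)).2.re = lam F p := by
    have e1 : transL (-p.1) ((0, 1) : CSp (Fin m)) = (0, 1) := by simp [transL_apply]
    have e2 : pdw (fun x => (F x).2) p = (Λ (0, 1)).2 :=
      (hΛ.clm (ContinuousLinearMap.snd ℂ _ _)).pdw_eq
    have e3 : ∀ i, pdw (fun x => (F x).1 i) p = (Λ (0, 1)).1 i := fun i =>
      (hΛ.clm (compL i)).pdw_eq
    rw [lam, e2]
    simp only [e3]
    rw [hΛ', ContinuousLinearMap.comp_apply, ContinuousLinearMap.comp_apply, e1, transL_apply]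
  refine ⟨Λ', hd, fun l => funext fun i => (hd.clm (compL i)).pdz_eq l, ?_, h2, ?_⟩
  · exact Complex.ext hlam h1
  · rw [← hlam]; exact h3

/-- By the Hessian identity, `ζ ↦ ∑ ζ_l E_l` scales `|·|²` by `λ`. The vectors `E_l / √λ` are
therefore orthonormal and extend to a unitary matrix. -/
theorem exists_isCompletion [DecidableEq ι] (hF : IsCRAt F p) (hp : p ∈ heis (Fin m))
    (hmem : ∀ᶠ x in 𝓝[heis (Fin m)] p, F x ∈ heis (Fin m ⊕ ι)) (hlam : 0 < lam F p) :
    ∃ C, IsCompletion F p C := by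
  obtain ⟨Λ, -, hE, -, -, hsq⟩ := Fp_first_order hF hp hmem
  obtain ⟨C, hC⟩ := exists_unitary_completion
    (LinearMap.fst ℂ _ _ ∘ₗ Λ.toLinearMap ∘ₗ LinearMap.inl ℂ _ _) hlam hsq
  refine ⟨C, hlam, ?_⟩
  convert hC using 2
  funext i k
  cases k with
  | inl l => simp [matA, hE]
  | inr l => rfl

theorem sum_vecE_mul_star [DecidableEq ι] {C : ι → Fin m ⊕ ι → ℂ} (hC : IsCompletion F p C)
    (l : Fin m) (k : ι) : ∑ i, vecE F p l i * star (C k i) = 0 := by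
  have h1 := Matrix.mem_unitaryGroup_iff'.1 hC.2
  have h2 := congrFun (congrFun h1 (Sum.inr k)) (Sum.inl l)
  rw [Matrix.mul_apply, Matrix.one_apply_ne (by simp)] at h2
  have h3 : (Real.sqrt (lam F p) : ℂ) ≠ 0 := by simpa using (Real.sqrt_pos.2 hC.1).ne'
  have h4 : (∑ i, vecE F p l i * star (C k i)) / (Real.sqrt (lam F p) : ℂ) = 0 := by
    rw [← h2, Finset.sum_div]
    refine Finset.sum_congr rfl fun i _ => ?_
    simp [matA, Matrix.star_apply]
    ring
  simpa [h3] using h4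

/-- The derivative of `φ_p^{**}` vanishes at `0`. -/
theorem autA_linF1_eq_zero [DecidableEq ι] (hF : IsCRAt F p) (hp : p ∈ heis (Fin m))
    (hmem : ∀ᶠ x in 𝓝[heis (Fin m)] p, F x ∈ heis (Fin m ⊕ ι)) (hΛ : HasCRDeriv F Λ p)
    {C : ι → Fin m ⊕ ι → ℂ} (hC : IsCompletion F p C) (v : CSp (Fin m)) (k : ι) :
    (autA (vecA F p C) (linF1 F p C (Λ v))).1 (Sum.inr k) = 0 := by
  have hFp : F p ∈ heis (Fin m ⊕ ι) := hmem.self_of_nhdsWithin hp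
  obtain ⟨Λp, hd, hE, hl, hg, -⟩ := Fp_first_order hF hp hmem
  have hd1 : HasCRDeriv (F1 F p C) ((nrmL (matA F p C) (lam F p)).comp Λp) 0 := by
    have : F1 F p C = fun x => nrmL (matA F p C) (lam F p) (Fp F p x) := by
      funext x; rw [nrmL_apply]; rfl
    rw [this]; exact hd.clm _
  have hd1' : HasCRDeriv (F1 F p C) ((linF1 F p C).comp (Λ.comp (transL (-p.1)))) 0 := by
    rw [funext (F1_eq C hFp)]
    exact ((hΛ.comp_sigma0 hp).sub_const (F p)).clm _
  have hlam : (lam F p : ℂ) ≠ 0 := by exact_mod_cast hC.1.ne'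
  have hb : ∀ k, vecA F p C k = (nrmL (matA F p C) (lam F p) (Λp (0, 1))).1 k := fun k =>
    (hd1.clm (compL k)).pdw_eq
  have key : ∀ v, (autA (vecA F p C) (nrmL (matA F p C) (lam F p) (Λp v))).1 (Sum.inr k) = 0 := by
    intro v
    have hv : v = ∑ l, v.1 l • ((Pi.single l 1, 0) : CSp (Fin m)) + v.2 • (0, 1) := by
      refine Prod.ext ?_ ?_
      · funext k
        simp [Prod.fst_sum, Pi.single_apply]
      · simp [Prod.snd_sum]
    let J := (compL (Sum.inr k)).comp ((autA (vecA F p C)).comp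
      ((nrmL (matA F p C) (lam F p)).comp Λp))
    change J v = 0
    -- Along `z_l` the last component has derivative zero, and the `φ` component is a multiple of
    -- the Hermitian product of `E_l` with `C_k`.
    have hJ1 : ∀ l, J (Pi.single l 1, 0) = 0 := by
      intro l
      change (autA (vecA F p C) (nrmL (matA F p C) (lam F p) (Λp _))).1 (Sum.inr k) = 0
      rw [autA_apply, nrmL_apply, hg, ← hE]
      have h5 : ∑ i, vecE F p l i * star (matA F p C i (Sum.inr k)) = 0 :=
        sum_vecE_mul_star hC l k
      simp only [zero_div, zero_smul, sub_zero, h5]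
    -- Along `w` the derivative of `g_p^*` is `λ / λ = 1`, so `aut` subtracts exactly the vector
    -- `∂f̃_p^* / ∂w`.
    have hJ2 : J (0, 1) = 0 := by
      change (autA (vecA F p C) (nrmL (matA F p C) (lam F p) (Λp _))).1 (Sum.inr k) = 0
      rw [autA_apply]
      have h6 : (nrmL (matA F p C) (lam F p) (Λp (0, 1))).2 = 1 := by
        rw [nrmL_apply, hl, div_self hlam]
      simp only [Pi.sub_apply, hb, h6, one_smul, sub_self]
    rw [hv]
    simp only [map_add, map_sum, map_smul, hJ1, hJ2, smul_zero, Finset.sum_const_zero, add_zero]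
  have hu : ∀ w, nrmL (matA F p C) (lam F p) (Λp w) =
      linF1 F p C (Λ (transL (-p.1) w)) := by
    intro w
    exact congrArg (fun L : CSp (Fin m) →L[ℂ] CSp (Fin m ⊕ ι) => L w) (hd1.unique hd1')
  -- The derivatives of `F` at `p` and of `F ∘ σ⁰_p` at `0` differ by the invertible map `transL
  -- (-p.1)`.
  obtain ⟨w, rfl⟩ := (LinearMap.injective_iff_surjective
    (f := (transL (-p.1) : CSp (Fin m) →ₗ[ℂ] _))).1 (injective_transL _) v
  have := key w
  rwa [hu] at this

end normalization

end CRGauss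

namespace CRGauss

variable {m : ℕ} {ι : Type} [Fintype ι]

/-! ### Locality -/

section congruence

variable {E : Type*} [NormedAddCommGroup E] [NormedSpace ℝ E] [NormedSpace ℂ E]
  [IsScalarTower ℝ ℂ E]

theorem HasCRDeriv.congr {h h' : CSp (Fin m) → E} {Λ : CSp (Fin m) →L[ℂ] E} {x : CSp (Fin m)}
    (hh : HasCRDeriv h Λ x) (hx : x ∈ heis (Fin m)) (he : h' =ᶠ[𝓝[heis (Fin m)] x] h) :
    HasCRDeriv h' Λ x :=
  HasFDerivAt.congr_of_eventuallyEq hh ((tendsto_par hx).eventually he)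

theorem IsCRAt.congr {h h' : CSp (Fin m) → E} {x : CSp (Fin m)}
    (hh : IsCRAt h x) (hx : x ∈ heis (Fin m)) (he : h' =ᶠ[𝓝[heis (Fin m)] x] h) :
    IsCRAt h' x := by
  refine ⟨hh.1.congr_of_eventuallyEq ((tendsto_par hx).eventually he), ?_⟩
  filter_upwards [hh.2, eventually_eventually_nhdsWithin.2 he, self_mem_nhdsWithin]
    with x' ⟨Λ, hΛ⟩ he' hx'
  exact ⟨Λ, hΛ.congr hx' he'⟩

end congruence

/-! ### Orders of vanishing -/

theorem norm_coord_le (x : CSp (Fin m)) : ‖coord x‖ ≤ ‖x‖ :=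
  max_le_max le_rfl (Complex.abs_re_le_norm x.2)

theorem dirD_sub_isBigO {h : CSp (Fin m) → ℂ} (hh : IsCRAt h 0) (v : (Fin m → ℂ) × ℝ) :
    (fun x => dirD h x v - dirD h 0 v) =O[𝓝[heis (Fin m)] 0] fun x => ‖x‖ := by
  have hd : DifferentiableAt ℝ (fderiv ℝ fun y => h (par y)) 0 :=
    (hh.1.fderiv_right (m := 1) (by norm_num)).differentiableAt (by simp)
  have h1 : (fun y => fderiv ℝ (fun y => h (par y)) y v -
      fderiv ℝ (fun y => h (par y)) 0 v) =O[𝓝 0] fun y : (Fin m → ℂ) × ℝ => y - 0 :=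
    ((ContinuousLinearMap.apply ℝ ℂ v).differentiableAt.comp (0 : (Fin m → ℂ) × ℝ) hd).isBigO_sub
  have h2 := h1.comp_tendsto (tendsto_coord (0 : CSp (Fin m)))
  refine h2.trans (IsBigO.of_bound 1 (Eventually.of_forall fun x => ?_))
  simpa using norm_coord_le x

theorem continuousWithinAt_dirD {h : CSp (Fin m) → ℂ} (hh : IsCRAt h 0) (v : (Fin m → ℂ) × ℝ) :
    ContinuousWithinAt (fun x => dirD h x v) (heis (Fin m)) 0 := by
  have hd : ContinuousAt (fderiv ℝ fun y => h (par y)) 0 :=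
    (hh.1.fderiv_right (m := 1) (by norm_num)).continuousAt
  exact ((ContinuousLinearMap.apply ℝ ℂ v).continuous.continuousAt.comp hd).tendsto.comp
    (tendsto_coord (0 : CSp (Fin m)))

/-- The first derivative vanishes at `0` and is differentiable there, hence is `O(‖y‖)`; the mean
value inequality on the ball of radius `‖y‖` supplies the second factor. -/
theorem isBigO_norm_sq {h : CSp (Fin m) → ℂ} (hh : IsCRAt h 0) (h0 : h 0 = 0)
    (hd : HasCRDeriv h 0 0) : h =O[𝓝[heis (Fin m)] 0] fun x => ‖x‖ ^ 2 := by
  set k : (Fin m → ℂ) × ℝ → ℂ := fun y => h (par y) with hk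
  have hpar0 : par (0 : (Fin m → ℂ) × ℝ) = 0 := par_coord (x := (0 : CSp (Fin m))) zero_mem_heis
  have hk0 : k 0 = 0 := by simp [hk, hpar0, h0]
  have hkC : ContDiffAt ℝ 2 k 0 := hh.1
  have hD0 : fderiv ℝ k 0 = 0 := by
    have := HasFDerivAt.fderiv hd
    refine this.trans ?_
    ext <;> simp
  have hD1 : DifferentiableAt ℝ (fderiv ℝ k) 0 :=
    (hkC.fderiv_right (m := 1) (by norm_num)).differentiableAt (by simp)
  have hO : (fderiv ℝ k) =O[𝓝 0] fun y : (Fin m → ℂ) × ℝ => y := by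
    simpa [hD0] using hD1.isBigO_sub
  obtain ⟨c, hc⟩ := hO.bound
  have hdiff : ∀ᶠ y in 𝓝 0, DifferentiableAt ℝ k y := by
    filter_upwards [hkC.eventually (by simp)] with y hy
    exact hy.differentiableAt (by simp)
  obtain ⟨r, hr, hball⟩ := Metric.eventually_nhds_iff_ball.1 (hc.and hdiff)
  have hk2 : k =O[𝓝 0] fun y : (Fin m → ℂ) × ℝ => ‖y‖ ^ 2 := by
    -- The absolute value is taken because the bound `c` is not known to be nonnegative.
    refine IsBigO.of_bound |c| ?_
    filter_upwards [Metric.ball_mem_nhds _ hr] with y hy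
    have hsub : ∀ x ∈ Metric.closedBall (0 : (Fin m → ℂ) × ℝ) ‖y‖,
        x ∈ Metric.ball (0 : (Fin m → ℂ) × ℝ) r := by
      intro x hx
      rw [mem_closedBall_zero_iff] at hx
      rw [mem_ball_zero_iff] at hy ⊢
      exact hx.trans_lt hy
    have := (convex_closedBall (0 : (Fin m → ℂ) × ℝ) ‖y‖).norm_image_sub_le_of_norm_fderiv_le
      (𝕜 := ℝ) (f := k) (C := |c| * ‖y‖) (x := 0) (y := y)
      (fun x hx => (hball x (hsub x hx)).2)
      (fun x hx => ((hball x (hsub x hx)).1.trans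
        (mul_le_mul_of_nonneg_right (le_abs_self c) (norm_nonneg _))).trans
        (mul_le_mul_of_nonneg_left (mem_closedBall_zero_iff.1 hx) (abs_nonneg c)))
      (by simp) (by simp)
    rw [hk0, sub_zero, sub_zero] at this
    rw [Real.norm_of_nonneg (by positivity)]
    linarith
  have h2 := hk2.comp_tendsto (tendsto_coord (0 : CSp (Fin m)))
  have h3 : (k ∘ coord) =ᶠ[𝓝[heis (Fin m)] 0] h := by
    filter_upwards [self_mem_nhdsWithin] with x hx
    simp [hk, par_coord hx]
  refine (h2.congr' h3 EventuallyEq.rfl).trans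
    (IsBigO.of_bound 1 (Eventually.of_forall fun x => ?_))
  have := norm_coord_le x
  simp only [Function.comp_apply, norm_pow, norm_norm, one_mul]
  gcongr

theorem IsCRAt.isBigO_norm {h : CSp (Fin m) → ℂ} (hh : IsCRAt h 0) (h0 : h 0 = 0) :
    h =O[𝓝[heis (Fin m)] 0] fun x => ‖x‖ := by
  have hd : DifferentiableAt ℝ (fun y => h (par y)) 0 := hh.1.differentiableAt (by simp)
  have hpar0 : par (0 : (Fin m → ℂ) × ℝ) = 0 := par_coord (x := (0 : CSp (Fin m))) zero_mem_heis
  have h1 : (fun y => h (par y)) =O[𝓝 0] fun y : (Fin m → ℂ) × ℝ => y := by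
    simpa [hpar0, h0] using hd.isBigO_sub
  have h2 := h1.comp_tendsto (tendsto_coord (0 : CSp (Fin m)))
  have h3 : ((fun y => h (par y)) ∘ coord) =ᶠ[𝓝[heis (Fin m)] 0] h := by
    filter_upwards [self_mem_nhdsWithin] with x hx
    simp [par_coord hx]
  refine (h2.congr' h3 EventuallyEq.rfl).trans
    (IsBigO.of_bound 1 (Eventually.of_forall fun x => ?_))
  simpa using norm_coord_le x

theorem isBigO_star_coord (j : Fin m) (c : ℂ) :
    (fun x : CSp (Fin m) => c * star (x.1 j)) =O[𝓝[heis (Fin m)] 0] fun _ => (1 : ℝ) := by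
  have : ContinuousAt (fun x : CSp (Fin m) => c * star (x.1 j)) 0 := by fun_prop
  exact (this.tendsto.isBigO_one ℝ).mono nhdsWithin_le_nhds

theorem isBigO_pdz {h : CSp (Fin m) → ℂ} {g : CSp (Fin m) → ℝ}
    (hh : ∀ v, (fun x => dirD h x v) =O[𝓝[heis (Fin m)] 0] g) (j : Fin m) :
    pdz j h =O[𝓝[heis (Fin m)] 0] g := by
  have h1 : wirt j h =O[𝓝[heis (Fin m)] 0] g :=
    ((hh _).sub ((hh _).const_mul_left Complex.I)).const_mul_left (1 / 2)
  have h2 : ∀ c : ℂ, (fun x => c * star (x.1 j) * opT h x) =O[𝓝[heis (Fin m)] 0] g := fun c => by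
    simpa [opT] using (isBigO_star_coord j c).mul (hh (0, 1))
  exact (h1.add (h2 Complex.I)).sub (h2 (2 * Complex.I))

theorem HasCRDeriv.dirD_isBigO {h : CSp (Fin m) → ℂ} (hd : HasCRDeriv h 0 0) (hh : IsCRAt h 0)
    (v : (Fin m → ℂ) × ℝ) : (fun x => dirD h x v) =O[𝓝[heis (Fin m)] 0] fun x => ‖x‖ := by
  simpa [hd.dirD_eq] using dirD_sub_isBigO hh v

theorem IsCRAt.dirD_isBigO_one {h : CSp (Fin m) → ℂ} (hh : IsCRAt h 0)
    (v : (Fin m → ℂ) × ℝ) : (fun x => dirD h x v) =O[𝓝[heis (Fin m)] 0] fun _ => (1 : ℝ) :=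
  (continuousWithinAt_dirD hh v).tendsto.isBigO_one ℝ

theorem isBigO_remainder {u φ D D' : CSp (Fin m) → ℂ}
    (hu : u =O[𝓝[heis (Fin m)] 0] fun x => ‖x‖) (hD : D =O[𝓝[heis (Fin m)] 0] fun x => ‖x‖)
    (hφ : φ =O[𝓝[heis (Fin m)] 0] fun x => ‖x‖ ^ 2)
    (hD' : D' =O[𝓝[heis (Fin m)] 0] fun _ => (1 : ℝ)) :
    (fun x => -u x * D x + φ x * D' x) =O[𝓝[heis (Fin m)] 0] fun x => ‖x‖ ^ 2 := by
  refine IsBigO.add ?_ ?_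
  · simpa [pow_two] using hu.neg_left.mul hD
  · simpa using hφ.mul hD'

/-! ### The Gauss map equation in terms of the renormalized map -/

theorem HasCRDeriv.const_add {h : CSp (Fin m) → ℂ} {Λ : CSp (Fin m) →L[ℂ] ℂ} {x : CSp (Fin m)}
    (hh : HasCRDeriv h Λ x) (a : ℂ) : HasCRDeriv (fun y => a + h y) Λ x :=
  HasFDerivAt.const_add a hh

/-- The projection `(f, φ, g) ↦ φ`. -/
def phiL : CSp (Fin m ⊕ ι) →ₗ[ℂ] ι → ℂ :=
  LinearMap.funLeft ℂ ℂ Sum.inr ∘ₗ LinearMap.fst ℂ _ _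

omit [Fintype ι] in
theorem phiL_apply (v : CSp (Fin m ⊕ ι)) (k : ι) : phiL v k = v.1 (Sum.inr k) := rfl

omit [Fintype ι] in
theorem surjective_phiL : Function.Surjective (phiL : CSp (Fin m ⊕ ι) →ₗ[ℂ] ι → ℂ) :=
  fun v => ⟨(Sum.elim 0 v, 0), rfl⟩

/-- The later normalizations do not spoil the vanishing of the `φ` component: the block map
multiplies it by `V`, and the translation vector `(-c, 0)` has no `φ` part. -/
theorem phiL_linF4 {F : CSp (Fin m) → CSp (Fin m ⊕ ι)} {p : CSp (Fin m)} {C : ι → Fin m ⊕ ι → ℂ}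
    (U : Matrix (Fin m) (Fin m) ℂ) (V : Matrix ι ι ℂ) (c : Fin m → ℂ) {v : CSp (Fin m ⊕ ι)}
    (hv : ∀ k, (autA (vecA F p C) (linF1 F p C v)).1 (Sum.inr k) = 0) :
    phiL (linF4 F p C U V c v) = 0 := by
  funext k
  have h1 : (fun k => (autA (vecA F p C) (linF1 F p C v)).1 (Sum.inr k)) = 0 := funext hv
  rw [phiL_apply, linF4, ContinuousLinearMap.comp_apply, ContinuousLinearMap.comp_apply,
    ContinuousLinearMap.comp_apply, autA_apply, blkL_apply]
  simp [h1]

theorem forall_basis_iff {W : Type*} [AddCommGroup W] [Module ℂ W] (L : CSp (Fin m) →ₗ[ℂ] W) :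
    ((∀ j, L (Pi.single j 1, 0) = 0) ∧ L (0, 1) = 0) ↔ ∀ v, L v = 0 := by
  refine ⟨fun ⟨h1, h2⟩ v => ?_, fun h => ⟨fun j => h _, h _⟩⟩
  have hv : v = ∑ l, v.1 l • ((Pi.single l 1, 0) : CSp (Fin m)) + v.2 • (0, 1) := by
    refine Prod.ext ?_ ?_
    · funext k
      simp [Prod.fst_sum, Pi.single_apply]
    · simp [Prod.snd_sum]
  rw [hv]
  simp only [map_add, map_sum, map_smul, h1, h2, smul_zero, Finset.sum_const_zero, add_zero]

/-- Subtracting `(1 - q) dφ + φ dq` from `dφ` leaves `q dφ - φ dq`, which is complex linear in the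
direction and so may be tested on the standard basis. -/
theorem HasCRDeriv.reduced_system_iff {H : CSp (Fin m) → CSp (Fin m ⊕ ι)}
    {L : CSp (Fin m) →L[ℂ] CSp (Fin m ⊕ ι)} {x : CSp (Fin m)} (hH : HasCRDeriv H L x)
    (ell : CSp (Fin m ⊕ ι) →L[ℂ] ℂ) :
    (∀ k, (∀ j, pdz j (fun y => (H y).1 (Sum.inr k)) x = remZ H ell j k x) ∧
        pdw (fun y => (H y).1 (Sum.inr k)) x = remW H ell k x) ↔
      ∀ v, (1 + ell (H x)) • phiL (L v) - ell (L v) • phiL (H x) = 0 := by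
  have hφ : ∀ k, HasCRDeriv (fun y => (H y).1 (Sum.inr k)) ((compL (Sum.inr k)).comp L) x :=
    fun k => hH.clm (compL (Sum.inr k))
  have hq : HasCRDeriv (fun y => 1 + ell (H y)) (ell.comp L) x := (hH.clm ell).const_add 1
  let T : CSp (Fin m) →ₗ[ℂ] ι → ℂ := (1 + ell (H x)) • (phiL ∘ₗ L.toLinearMap) -
    (ell.toLinearMap ∘ₗ L.toLinearMap).smulRight (phiL (H x))
  have hT : ∀ v, T v = (1 + ell (H x)) • phiL (L v) - ell (L v) • phiL (H x) := fun v => rfl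
  have key : ∀ v k, (L v).1 (Sum.inr k) = -ell (H x) * (L v).1 (Sum.inr k) +
      (H x).1 (Sum.inr k) * ell (L v) ↔ T v k = 0 := by
    intro v k
    rw [hT]
    simp only [Pi.sub_apply, Pi.smul_apply, smul_eq_mul, phiL_apply]
    rw [← sub_eq_zero]
    refine Eq.congr_left ?_
    ring
  have hZ : ∀ j k, (pdz j (fun y => (H y).1 (Sum.inr k)) x = remZ H ell j k x ↔
      T (Pi.single j 1, 0) k = 0) := by
    intro j k
    have h1 : remZ H ell j k x = -ell (H x) * pdz j (fun y => (H y).1 (Sum.inr k)) x +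
      (H x).1 (Sum.inr k) * pdz j (fun y => 1 + ell (H y)) x := rfl
    rw [← key, h1, (hφ k).pdz_eq, hq.pdz_eq]
    rfl
  have hW : ∀ k, (pdw (fun y => (H y).1 (Sum.inr k)) x = remW H ell k x ↔
      T (0, 1) k = 0) := by
    intro k
    have h1 : remW H ell k x = -ell (H x) * pdw (fun y => (H y).1 (Sum.inr k)) x +
      (H x).1 (Sum.inr k) * pdw (fun y => 1 + ell (H y)) x := rfl
    rw [← key, h1, (hφ k).pdw_eq, hq.pdw_eq]
    rfl
  refine Iff.trans ?_ (forall_basis_iff T)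
  simp only [hZ, hW, forall_and, funext_iff]
  exact and_congr_left' forall_comm

/-- The core of the proof, at a fixed point `p`: nothing about the normal form enters, only that `P`
is invertible near `p` and that the completion is admissible. -/
theorem exists_reduced_gauss_equation [DecidableEq ι] {F : CSp (Fin m) → CSp (Fin m ⊕ ι)}
    {p : CSp (Fin m)} (hF : IsCRAt F p) (hp : p ∈ heis (Fin m))
    (hmem : ∀ᶠ x in 𝓝[heis (Fin m)] p, F x ∈ heis (Fin m ⊕ ι))
    (hP : ∀ᶠ x in 𝓝[heis (Fin m)] p, IsUnit (gaussP F x).det)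
    {C : ι → Fin m ⊕ ι → ℂ} (hC : IsCompletion F p C)
    {U : Matrix (Fin m) (Fin m) ℂ} (hU : U ∈ Matrix.unitaryGroup (Fin m) ℂ)
    {V : Matrix ι ι ℂ} (hV : V ∈ Matrix.unitaryGroup ι ℂ) (c : Fin m → ℂ) :
    ∃ ell : CSp (Fin m ⊕ ι) →ₗ[ℂ] ℂ,
      (∀ j k, remZ (F4 F p C U V c) ell j k =O[𝓝[heis (Fin m)] 0] fun x => ‖x‖ ^ 2) ∧
      (∀ k, remW (F4 F p C U V c) ell k =O[𝓝[heis (Fin m)] 0] fun x => ‖x‖ ^ 2) ∧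
      ∀ᶠ x in 𝓝[heis (Fin m)] 0,
        (gauss F (srcChange p U c x) = gauss F p ↔
          ∀ k,
            (∀ j, pdz j (fun y => (F4 F p C U V c y).1 (Sum.inr k)) x =
              remZ (F4 F p C U V c) ell j k x) ∧
            pdw (fun y => (F4 F p C U V c y).1 (Sum.inr k)) x =
              remW (F4 F p C U V c) ell k x) := by
  have hFp : F p ∈ heis (Fin m ⊕ ι) := hmem.self_of_nhdsWithin hp
  obtain ⟨Λp, hΛp⟩ := hF.exists_deriv hp
  have hPp := hP.self_of_nhdsWithin hp
  set A := linF4 F p C U V c with hA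
  set M := denF4 F p C U V c with hM
  have hAinj : Function.Injective A := injective_linF4 C U V c hC hU hV
  set e := LinearEquiv.ofInjectiveEndo (A : CSp (Fin m ⊕ ι) →ₗ[ℂ] _) hAinj with he
  set B : CSp (Fin m ⊕ ι) →L[ℂ] CSp (Fin m ⊕ ι) :=
    LinearMap.toContinuousLinearMap e.symm.toLinearMap with hB
  have hBA : ∀ v, B (A v) = v := fun v => e.symm_apply_apply v
  set H := F4 F p C U V c with hH
  set K : CSp (Fin m) → CSp (Fin m ⊕ ι) := fun x => F (srcChange p U c x) - F p with hK
  have hΨ0 := srcChange_zero p U c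
  have hΨt := tendsto_srcChange hp hU c
  have hK0 : K 0 = 0 := by simp [hK, hΨ0]
  have hFΨ : IsCRAt (fun x => F (srcChange p U c x)) 0 := IsCRAt.comp_right (by rwa [hΨ0])
    zero_mem_heis (contDiffAt_srcChange p U c (by simp)) (eventually_srcChange_mem hp hU c)
  have hKcr : IsCRAt K 0 := hFΨ.comp_left (G := fun v => v - F p) zero_mem_heis
    (contDiffAt_id.sub contDiffAt_const)
  have hKt : Tendsto K (𝓝[heis (Fin m)] 0) (𝓝 0) := by
    have := (hKcr.continuousWithinAt zero_mem_heis).tendsto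
    rwa [hK0] at this
  have hHK : H =ᶠ[𝓝[heis (Fin m)] 0] fun x => projMap A M (K x) := by
    filter_upwards [hKt.eventually (eventually_one_add_ne_zero (denF2 F p C))] with x hx
    exact F4_eq C U V c hFp x hx
  have hH0 : H 0 = 0 := by
    refine (hHK.self_of_nhdsWithin zero_mem_heis).trans ?_
    simp only [hK0, projMap_zero]
  have hHcr : IsCRAt H 0 := (hKcr.comp_left zero_mem_heis
    (contDiffAt_projMap A M (by simp [hK0]))).congr zero_mem_heis hHK
  -- the derivatives of `K` and `H` at the points near `0`
  have hKd : ∀ x ∈ heis (Fin m), 1 + autM c 0 x ≠ 0 → ∀ Λ, HasCRDeriv F Λ (srcChange p U c x) →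
      (∀ᶠ x' in 𝓝[heis (Fin m)] x, srcChange p U c x' ∈ heis (Fin m)) →
      HasCRDeriv K (Λ.comp (srcDeriv p U c x)) x := fun x hx hx1 Λ hΛ hev =>
    (hΛ.comp_right hx (hasFDerivAt_srcChange p U c hx1) hev).sub_const (F p)
  have hK'0 : HasCRDeriv K (Λp.comp (srcDeriv p U c 0)) 0 :=
    hKd 0 zero_mem_heis (by simp) Λp (by rwa [hΨ0]) (eventually_srcChange_mem hp hU c)
  have hker0 : ∀ v, phiL (A (Λp v)) = 0 := fun v =>
    phiL_linF4 U V c fun k => autA_linF1_eq_zero hF hp hmem hΛp hC v k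
  -- Both maps are surjective onto `ℂ^{N-n}` and kill the `n`-dimensional image of the derivative of
  -- `F` at `p`.
  have hker : LinearMap.ker (gaussKer (gauss F p)) =
      LinearMap.ker (phiL ∘ₗ (A : CSp (Fin m ⊕ ι) →ₗ[ℂ] CSp (Fin m ⊕ ι))) := by
    refine ker_eq_ker_of_comp_eq_zero (Λp : CSp (Fin m) →ₗ[ℂ] CSp (Fin m ⊕ ι))
      (hΛp.injective hPp) _ _ (surjective_gaussKer _) ?_ ?_ ?_ hker0
    · exact surjective_phiL.comp (LinearMap.injective_iff_surjective.1 hAinj)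
    · simp [Module.finrank_prod]
      ring
    · exact (hΛp.gauss_eq_iff hPp _).1 rfl
  have hφd : ∀ k, HasCRDeriv (fun y => (H y).1 (Sum.inr k)) 0 0 := by
    intro k
    have hG : HasFDerivAt (projMap A M) A (K 0) := by
      rw [hK0]; exact hasFDerivAt_projMap_zero A M
    have h1 := ((hK'0.comp_left zero_mem_heis hG).congr zero_mem_heis hHK).clm (compL (Sum.inr k))
    have h2 : (compL (Sum.inr k)).comp (A.comp (Λp.comp (srcDeriv p U c 0))) = 0 :=
      ContinuousLinearMap.ext fun v => congrFun (hker0 (srcDeriv p U c 0 v)) k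
    rwa [h2] at h1
  -- Chosen so that `1 + ell ∘ H = 1 / (1 + M K)` near `0`.
  set ell : CSp (Fin m ⊕ ι) →L[ℂ] ℂ := -(M.comp B) with hell
  have hφcr : ∀ k, IsCRAt (fun y => (H y).1 (Sum.inr k)) 0 := fun k =>
    hHcr.comp_left zero_mem_heis (compL (Sum.inr k)).contDiff.contDiffAt
  have hellcr : IsCRAt (fun y => ell (H y)) 0 :=
    hHcr.comp_left zero_mem_heis ell.contDiff.contDiffAt
  have hqcr : IsCRAt (fun y => 1 + ell (H y)) 0 :=
    hHcr.comp_left (G := fun v => 1 + ell v) zero_mem_heis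
      (contDiffAt_const.add ell.contDiff.contDiffAt)
  have hellO := hellcr.isBigO_norm (by simp [hH0])
  have hφO : ∀ k, (fun y => (H y).1 (Sum.inr k)) =O[𝓝[heis (Fin m)] 0] fun x => ‖x‖ ^ 2 :=
    fun k => isBigO_norm_sq (hφcr k) (by simp [hH0]) (hφd k)
  refine ⟨ell, fun j k => ?_, fun k => ?_, ?_⟩
  · exact isBigO_remainder hellO (isBigO_pdz (fun v => (hφd k).dirD_isBigO (hφcr k) v) j) (hφO k)
      (isBigO_pdz (fun v => hqcr.dirD_isBigO_one v) j)
  · exact isBigO_remainder hellO ((hφd k).dirD_isBigO (hφcr k) (0, 1)) (hφO k)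
      (hqcr.dirD_isBigO_one (0, 1))
  · filter_upwards [hΨt.eventually hF.2, hΨt.eventually hP, self_mem_nhdsWithin,
      (eventually_one_add_ne_zero (autM c 0)).filter_mono nhdsWithin_le_nhds,
      eventually_eventually_nhdsWithin.2 (eventually_srcChange_mem hp hU c),
      hKt.eventually (eventually_one_add_ne_zero M), eventually_eventually_nhdsWithin.2 hHK]
      with x ⟨Λ, hΛ⟩ hPx hx hx1 hev hMx hHKx
    have hKx := hKd x hx hx1 Λ hΛ hev
    have hHx := (hKx.comp_left hx (hasFDerivAt_projMap A M hMx)).congr hx hHKx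
    have hHKe : H x = projMap A M (K x) := hHKx.self_of_nhdsWithin hx
    set Λ' := Λ.comp (srcDeriv p U c x) with hΛ'
    have hs : (1 + M (K x))⁻¹ ^ 2 ≠ 0 := pow_ne_zero _ (inv_ne_zero hMx)
    set G' := ((1 + M (K x))⁻¹ • A - ((1 + M (K x))⁻¹ ^ 2) • M.smulRight (A (K x))) with hG'
    have hR : (∀ k, (∀ j, pdz j (fun y => (H y).1 (Sum.inr k)) x = remZ H ell j k x) ∧
        pdw (fun y => (H y).1 (Sum.inr k)) x = remW H ell k x) ↔
        ∀ v, phiL (A (Λ' v)) = 0 := by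
      rw [hHx.reduced_system_iff]
      refine forall_congr' fun v => ?_
      have h1 := projMap_quotient_rule hBA phiL hMx (Λ' v)
      rw [← hHKe, ← hG'] at h1
      have h2 : ∀ w, ell w = -(M (B w)) := fun w => rfl
      rw [ContinuousLinearMap.comp_apply, h2, h2, ← sub_eq_add_neg, neg_smul, sub_neg_eq_add, h1,
        smul_eq_zero_iff_right hs]
    rw [hR, hΛ.gauss_eq_iff hPx]
    have hk : ∀ w, gaussKer (gauss F p) w = 0 ↔ phiL (A w) = 0 := fun w => by
      have := SetLike.ext_iff.1 hker w
      simpa using this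
    simp only [hk]
    -- The derivative of the source change is onto, so testing along `dK` is the same as testing
    -- along `dF`.
    refine ⟨fun h v => h _, fun h v => ?_⟩
    obtain ⟨w, rfl⟩ := surjective_srcDeriv p hU c hx1 v
    exact h w

end CRGauss

namespace CRGauss

variable {m : ℕ} {ι : Type} [Fintype ι]

/-! ### Continuity at the origin -/

section continuity

variable {F : CSp (Fin m) → CSp (Fin m ⊕ ι)}

theorem continuousWithinAt_star_coord (j : Fin m) :
    ContinuousWithinAt (fun x : CSp (Fin m) => star (x.1 j)) (heis (Fin m)) 0 := by
  have : Continuous (fun x : CSp (Fin m) => star (x.1 j)) := by fun_prop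
  exact this.continuousWithinAt

theorem continuousWithinAt_rowOp {h : CSp (Fin m) → ℂ} (hh : IsCRAt h 0) (a : Fin m ⊕ Unit) :
    ContinuousWithinAt (rowOp a h) (heis (Fin m)) 0 := by
  cases a with
  | inl j =>
    exact (continuousWithinAt_const.mul ((continuousWithinAt_dirD hh _).sub
      (continuousWithinAt_const.mul (continuousWithinAt_dirD hh _)))).add
      ((continuousWithinAt_const.mul (continuousWithinAt_star_coord j)).mul
        (continuousWithinAt_dirD hh _))
  | inr _ => exact continuousWithinAt_dirD hh _

theorem IsCRAt.comp_clm {E E' : Type*} [NormedAddCommGroup E] [NormedSpace ℝ E] [NormedSpace ℂ E]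
    [IsScalarTower ℝ ℂ E] [NormedAddCommGroup E'] [NormedSpace ℝ E'] [NormedSpace ℂ E']
    [IsScalarTower ℝ ℂ E'] {h : CSp (Fin m) → E} {x : CSp (Fin m)} (hh : IsCRAt h x)
    (hx : x ∈ heis (Fin m)) (G : E →L[ℂ] E') : IsCRAt (fun y => G (h y)) x :=
  hh.comp_left hx G.contDiff.contDiffAt

theorem continuousWithinAt_gaussP (hF : IsCRAt F 0) :
    ContinuousWithinAt (gaussP F) (heis (Fin m)) 0 := by
  refine continuousWithinAt_pi.2 fun a => continuousWithinAt_pi.2 fun b => ?_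
  cases b with
  | inl l => exact continuousWithinAt_rowOp (hF.comp_clm zero_mem_heis (compL (Sum.inl l))) a
  | inr _ =>
    exact continuousWithinAt_rowOp (hF.comp_clm zero_mem_heis (ContinuousLinearMap.snd ℂ _ _)) a

theorem continuousWithinAt_lam (hF : IsCRAt F 0) :
    ContinuousWithinAt (lam F) (heis (Fin m)) 0 := by
  have hc : ∀ i, ContinuousWithinAt (fun x => star ((F x).1 i)) (heis (Fin m)) 0 := fun i =>
    (Complex.continuous_conj.comp
      (compL (β := Fin m ⊕ ι) i).continuous).continuousAt.comp_continuousWithinAt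
      (hF.continuousWithinAt zero_mem_heis)
  have hw : ∀ h : CSp (Fin m) → ℂ, IsCRAt h 0 → ContinuousWithinAt (pdw h) (heis (Fin m)) 0 :=
    fun h hh => continuousWithinAt_rowOp hh (Sum.inr ())
  have h1 : ContinuousWithinAt (fun p => pdw (fun x => (F x).2) p -
      2 * Complex.I * ∑ i, pdw (fun x => (F x).1 i) p * star ((F p).1 i)) (heis (Fin m)) 0 := by
    refine (hw _ (hF.comp_clm zero_mem_heis (ContinuousLinearMap.snd ℂ _ _))).sub
      (continuousWithinAt_const.mul ?_)
    refine tendsto_finsetSum _ fun i _ => ?_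
    exact (hw _ (hF.comp_clm zero_mem_heis (compL i))).mul (hc i)
  exact Complex.continuous_re.continuousAt.comp_continuousWithinAt h1

theorem eventually_isUnit_det_gaussP (hF : IsCRAt F 0) (h0 : IsUnit (gaussP F 0).det) :
    ∀ᶠ p in 𝓝[heis (Fin m)] 0, IsUnit (gaussP F p).det := by
  have h1 : ContinuousWithinAt (fun p => (gaussP F p).det) (heis (Fin m)) 0 :=
    (Continuous.matrix_det continuous_id).continuousAt.comp_continuousWithinAt
      (continuousWithinAt_gaussP hF)
  filter_upwards [h1.eventually_ne h0.ne_zero] with p hp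
  exact isUnit_iff_ne_zero.2 hp

end continuity

/-! ### The normal form to first order -/

theorem IsOwt.tendsto_zero {k : ℕ} (hk : k ≠ 0) {h : CSp (Fin m) → ℂ} (hh : IsOwt k h) :
    Tendsto h (𝓝[heis (Fin m)] 0) (𝓝 0) := by
  refine hh.trans_tendsto ?_
  have h1 : Continuous (fun x : CSp (Fin m) => (‖x.1‖ + Real.sqrt ‖x.2‖) ^ k) := by fun_prop
  have h2 := h1.tendsto 0
  simp only [Prod.fst_zero, Prod.snd_zero, norm_zero, Real.sqrt_zero, add_zero, zero_pow hk] at h2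
  exact h2.mono_left nhdsWithin_le_nhds

/-- A function that equals `z_l` up to `∑ z_j o(1)` has CR derivative `z_l` at `0`. -/
theorem hasCRDeriv_of_sum {f : CSp (Fin m) → ℂ} {s : Finset (Fin m)} {l : Fin m} (hl : l ∈ s)
    {a : Fin m → CSp (Fin m) → ℂ} (hf : ∀ᶠ x in 𝓝[heis (Fin m)] 0, f x = ∑ j ∈ s, x.1 j * a j x)
    (ha : ∀ j ∈ s, Tendsto (a j) (𝓝[heis (Fin m)] 0) (𝓝 (if l = j then 1 else 0))) :
    HasCRDeriv f (compL l) 0 := by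
  have ht : Tendsto par (𝓝 (0 : (Fin m → ℂ) × ℝ)) (𝓝[heis (Fin m)] 0) :=
    tendsto_par (x := (0 : CSp (Fin m))) zero_mem_heis
  have hpar0 : par (0 : (Fin m → ℂ) × ℝ) = 0 := par_coord (x := (0 : CSp (Fin m))) zero_mem_heis
  have hf0 : f 0 = 0 := by
    rw [hf.self_of_nhdsWithin zero_mem_heis]; simp
  have key : (fun y : (Fin m → ℂ) × ℝ => f (par y) - y.1 l) =o[𝓝 0] fun y => y := by
    have h1 : (fun y : (Fin m → ℂ) × ℝ => ∑ j ∈ s, y.1 j * (a j (par y) - if l = j then 1 else 0))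
        =o[𝓝 0] fun y => y := by
      refine IsLittleO.fun_sum fun j hj => ?_
      have h2 : (fun y : (Fin m → ℂ) × ℝ => y.1 j) =O[𝓝 0] fun y : (Fin m → ℂ) × ℝ => y :=
        IsBigO.of_bound 1 (Eventually.of_forall fun y => by
          rw [one_mul]; exact (norm_le_pi_norm y.1 j).trans (norm_fst_le y))
      have h3 : (fun y : (Fin m → ℂ) × ℝ => a j (par y) - if l = j then 1 else 0) =o[𝓝 0]
          fun _ => (1 : ℝ) := by
        rw [isLittleO_one_iff]
        simpa using ((ha j hj).comp ht).sub_const (if l = j then (1 : ℂ) else 0)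
      have h4 := h2.norm_right.mul_isLittleO h3
      exact (isLittleO_norm_right.1 (by simpa using h4))
    refine h1.congr' ?_ EventuallyEq.rfl
    filter_upwards [ht.eventually hf] with y hy
    rw [hy]
    simp only [mul_sub, Finset.sum_sub_distrib, mul_ite, mul_one, mul_zero, Finset.sum_ite_eq, hl,
      if_true]
    rfl
  refine HasFDerivAt.of_isLittleO ?_
  change (fun y => f (par y) - f (par 0) - compL l (dpar 0 (y - 0))) =o[𝓝 0] fun y => y - 0
  simpa [hpar0, hf0, dpar_apply, compL] using key

/-- In `f_l` each coefficient is multiplied by some `z_j`, so its limit at `0` already determines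
the first derivative. -/
theorem tendsto_normal_form_coeff {h : CSp (Fin m) → ℂ} {β : ℂ} (b : (Fin m → ℂ) →ₗ[ℂ] ℂ)
    {l j : Fin m}
    (hh : IsOwt 4 fun x => h x - ((if l = j then 1 + β * x.2 else 0) + b x.1 * x.2)) :
    Tendsto h (𝓝[heis (Fin m)] 0) (𝓝 (if l = j then 1 else 0)) := by
  have h1 := hh.tendsto_zero (by norm_num)
  have hb : Continuous b := b.continuous_of_finiteDimensional
  have h2 : Continuous fun x : CSp (Fin m) => (if l = j then 1 + β * x.2 else 0) + b x.1 * x.2 := by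
    split_ifs <;> fun_prop
  have h3 := (h2.tendsto 0).mono_left (nhdsWithin_le_nhds (s := heis (Fin m)))
  simpa using h1.add h3

theorem hasCRDeriv_clm {E : Type*} [NormedAddCommGroup E] [NormedSpace ℝ E] [NormedSpace ℂ E]
    [IsScalarTower ℝ ℂ E] (L : CSp (Fin m) →L[ℂ] E) (x : CSp (Fin m)) : HasCRDeriv L L x :=
  HasFDerivAt.comp (coord x) (L.restrictScalars ℝ).hasFDerivAt (hasFDerivAt_par (coord x))

omit [Fintype ι] in
theorem gaussP_zero_eq_one {F : CSp (Fin m) → CSp (Fin m ⊕ ι)}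
    (hf : ∀ l, HasCRDeriv (fun x => (F x).1 (Sum.inl l)) (compL l) 0)
    (hg : HasCRDeriv (fun x => (F x).2) (ContinuousLinearMap.snd ℂ _ _) 0) : gaussP F 0 = 1 := by
  ext a b
  cases b with
  | inl l =>
    refine ((hf l).rowOp_eq a).trans ?_
    cases a with
    | inl j => simp [rowVec, compL, Matrix.one_apply, Pi.single_apply, eq_comm]
    | inr _ => simp [rowVec, compL]
  | inr _ =>
    refine (hg.rowOp_eq a).trans ?_
    cases a with
    | inl j => simp [rowVec]
    | inr _ => simp [rowVec]

/-- To first order the normal form has `f = z` and `g = w`, and the terms `2 i z̄_j` in the rows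
vanish at the origin. -/
theorem HasNormalForm.gaussP_zero {n N κ : ℕ}
    {F : CSp (Fin (n - 1)) → CSp (Fin (n - 1) ⊕ S n N κ)} (hF : HasNormalForm F) :
    gaussP F 0 = 1 := by
  obtain ⟨μ, b, fs, φs, h⟩ := hF
  refine gaussP_zero_eq_one (fun l => ?_) ?_
  · by_cases hl : l.val < κ
    · refine hasCRDeriv_of_sum (s := Finset.univ.filter fun j : Fin (n - 1) => j.val < κ)
        (a := fs l) (by simpa using hl) ?_ fun j hj =>
        tendsto_normal_form_coeff (b l j) (h.fs_expansion l j hl (by simpa using hj))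
      filter_upwards [h.f_low] with x hx
      exact hx l hl
    · refine hasCRDeriv_of_sum (s := {l}) (a := fun _ _ => 1) (by simp) ?_ fun j hj => ?_
      · filter_upwards [h.f_high] with x hx
        simpa using hx l (not_lt.1 hl)
      · obtain rfl := Finset.mem_singleton.1 hj
        simpa using tendsto_const_nhds
  · exact (hasCRDeriv_clm (ContinuousLinearMap.snd ℂ _ _) 0).congr zero_mem_heis h.g_eq

end CRGauss

/-! ### The theorem, from the local statement at each point `p` near `0`. -/

theorem theorem3p1 (n N κ : ℕ) (hκ1 : 1 ≤ κ) (hκn : κ ≤ n - 1)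
    (hN : n + κ * (2 * n - κ - 1) / 2 ≤ N)
    (D : Set (CRGauss.CSp (Fin (n - 1)))) (hD : IsOpen D) (h0 : 0 ∈ D)
    (F : CRGauss.CSp (Fin (n - 1)) → CRGauss.CSp (Fin (n - 1) ⊕ CRGauss.S n N κ))
    (hF : CRGauss.IsCRImmersion F D)
    (hrank : CRGauss.HasMaxGeomRankAtZero F D κ)
    (hform : CRGauss.HasNormalForm F) :
    ∀ᶠ p in 𝓝[CRGauss.heis (Fin (n - 1))] 0,
      -- the Gauss map and the renormalized maps are well defined at `p`
      IsUnit (CRGauss.gaussP F p).det ∧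
      (∃ C, CRGauss.IsCompletion F p C) ∧
      -- the Gauss map equation in terms of any of the renormalized maps
      ∀ C, CRGauss.IsCompletion F p C →
      ∀ U ∈ Matrix.unitaryGroup (Fin (n - 1)) ℂ,
      ∀ V ∈ Matrix.unitaryGroup (CRGauss.S n N κ) ℂ,
      ∀ c : Fin (n - 1) → ℂ,
      ∃ ell : CRGauss.CSp (Fin (n - 1) ⊕ CRGauss.S n N κ) →ₗ[ℂ] ℂ,
        (∀ j k, CRGauss.remZ (CRGauss.F4 F p C U V c) ell j k
          =O[𝓝[CRGauss.heis (Fin (n - 1))] 0] fun x => ‖x‖ ^ 2) ∧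
        (∀ k, CRGauss.remW (CRGauss.F4 F p C U V c) ell k
          =O[𝓝[CRGauss.heis (Fin (n - 1))] 0] fun x => ‖x‖ ^ 2) ∧
        ∀ᶠ x in 𝓝[CRGauss.heis (Fin (n - 1))] 0,
          (CRGauss.gauss F (CRGauss.srcChange p U c x) = CRGauss.gauss F p ↔
            ∀ k,
              (∀ j, CRGauss.pdz j (fun y => (CRGauss.F4 F p C U V c y).1 (Sum.inr k)) x =
                CRGauss.remZ (CRGauss.F4 F p C U V c) ell j k x) ∧
              CRGauss.pdw (fun y => (CRGauss.F4 F p C U V c y).1 (Sum.inr k)) x =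
                CRGauss.remW (CRGauss.F4 F p C U V c) ell k x) := by
  have hCR : ∀ p ∈ CRGauss.heis (Fin (n - 1)), p ∈ D → CRGauss.IsCRAt F p := fun p hp hpD =>
    CRGauss.isCRAt_of_isCRImmersion hF hD hp hpD
  have hF0 := hCR 0 CRGauss.zero_mem_heis h0
  have hP := CRGauss.eventually_isUnit_det_gaussP hF0 (by simp [hform.gaussP_zero])
  -- The geometric rank at `0` is computed from an admissible completion, which carries `λ(0) > 0`.
  obtain ⟨C₀, hC₀, -⟩ := hrank.1
  have hlam : ∀ᶠ p in 𝓝[CRGauss.heis (Fin (n - 1))] 0, 0 < CRGauss.lam F p :=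
    (CRGauss.continuousWithinAt_lam hF0).tendsto.eventually (lt_mem_nhds hC₀.1)
  -- Invertibility of `P` is needed at `p` and also at all nearby points, where `γ` is compared with
  -- `γ(p)`.
  filter_upwards [hP, hlam, eventually_eventually_nhdsWithin.2 hP, self_mem_nhdsWithin,
    mem_nhdsWithin_of_mem_nhds (hD.mem_nhds h0)] with p hPp hlamp hPev hp hpD
  have hmem : ∀ᶠ x in 𝓝[CRGauss.heis (Fin (n - 1))] p,
      F x ∈ CRGauss.heis (Fin (n - 1) ⊕ CRGauss.S n N κ) := by
    filter_upwards [self_mem_nhdsWithin, mem_nhdsWithin_of_mem_nhds (hD.mem_nhds hpD)] with x hx hxD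
    exact hF.mapsTo ⟨hx, hxD⟩
  exact ⟨hPp, CRGauss.exists_isCompletion (hCR p hp hpD) hp hmem hlamp,
    fun C hC U hU V hV c =>
      CRGauss.exists_reduced_gauss_equation (hCR p hp hpD) hp hmem hPev hC hU hV c⟩
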